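/- Let $G$ be a Frobenius group with Frobenius kernel $N$; that is, $G$ is a finite group, $N$ is a normal subgroup of $G$, and $G = N \rtimes H$ for some proper nontrivial subgroup $H$ of $G$ with $H \cap gHg^{-1} = \{1\}$ for all $g \in G \setminus H$. Let $p$ be a prime not dividing $|N|$, and put $e_N = |N|^{-1}\sum_{\sigma\in N}\sigma \in \mathbb{Q}_p[G]$. Then $\mathbb{Z}_p[G]$ is $N$-hybrid: there is a maximal $\mathbb{Z}_p$-order $\mathfrak{M}_p(G)$ with $\mathbb{Z}_p[G] \subseteq \mathfrak{M}_p(G) \subseteq \mathbb{Q}_p[G]$ such that \[ \mathbb{Z}_p[G] = \mathbb{Z}_p[G]e_N \oplus \mathfrak{M}_p(G)(1-e_N). \] Consequently, let $J$ be the (finite) set of primitive central idempotents $e$ of $\mathbb{Q}_p[G]$ with $e\,e_N = 0$; for $e \in J$ let $F_e$ be the centre of the simple algebra $\mathbb{Q}_p[G]e$, and let $\mathcal{O}_e$ be the integral closure of $\mathbb{Z}_p$ in $F_e$. Then for every $e \in J$ the ring $\mathcal{O}_e$ is unramified over $\mathbb{Z}_p$, and there are integers $m_e$ such that $\mathbb{Q}_p[G]e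 \cong M_{m_e\times m_e}(F_e)$ as $\mathbb{Q}_p$-algebras for every $e\in J$, and \[ \mathbb{Z}_p[G] \;\cong\; \mathbb{Z}_p[G/N] \oplus \bigoplus_{e\in J} M_{m_e\times m_e}(\mathcal{O}_e) \] as $\mathbb{Z}_p$-algebras. -/

import Mathlib

universe u

/-- A Frobenius complement in a finite group `G`: a proper nontrivial subgroup `H` such that
`H ∩ gHg⁻¹ = 1` for all `g ∉ H`.  A Frobenius group is a finite group having such a subgroup. -/
structure IsFrobeniusComplement {G : Type u} [Group G] (H : Subgroup G) : Prop where
  ne_bot : H ≠ ⊥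
  ne_top : H ≠ ⊤
  inf_conj : ∀ g : G, g ∉ H → H ⊓ H.map (MulAut.conj g).toMonoidHom = ⊥

/-- `N` is the Frobenius kernel of `G`: a normal subgroup such that `G` is the (internal) semidirect
product `N ⋊ H` for some Frobenius complement `H`. In particular `G` is then a Frobenius group. -/
structure IsFrobeniusKernel {G : Type u} [Group G] (N : Subgroup G) : Prop where
  normal : N.Normal
  exists_complement : ∃ H : Subgroup G, IsFrobeniusComplement H ∧ N.IsComplement' H

section Orders

variable (p : ℕ) [Fact p.Prime] {A : Type u} [Ring A] [Algebra ℤ_[p] A] [Algebra ℚ_[p] A]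

/-- A `ℤ_p`-order of full rank in the `ℚ_p`-algebra `A`: a `ℤ_p`-subalgebra that is finitely
generated as a `ℤ_p`-module and spans `A` over `ℚ_p`. -/
structure IsPadicOrder (Γ : Subalgebra ℤ_[p] A) : Prop where
  finite : Module.Finite ℤ_[p] Γ
  span_eq_top : Submodule.span ℚ_[p] (Γ : Set A) = ⊤

/-- A maximal `ℤ_p`-order in the `ℚ_p`-algebra `A`. -/
def IsMaximalPadicOrder (Γ : Subalgebra ℤ_[p] A) : Prop :=
  Maximal (IsPadicOrder p) Γ

end Orders

section GroupRing

variable (p : ℕ) [Fact p.Prime] {G : Type u} [Group G]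

/-- The group ring `ℤ_p[G]` as a `ℤ_p`-subalgebra of `ℚ_p[G]`. -/
noncomputable def integralGroupRing (G : Type u) [Group G] :
    Subalgebra ℤ_[p] (MonoidAlgebra ℚ_[p] G) :=
  (MonoidAlgebra.mapAlgHom G (Algebra.ofId ℤ_[p] ℚ_[p])).range

/-- The trace idempotent `e_N = |N|⁻¹ ∑_{σ ∈ N} σ` in `ℚ_p[G]`, for a finite subgroup `N`. -/
noncomputable def traceIdempotent (N : Subgroup G) : MonoidAlgebra ℚ_[p] G :=
  (Nat.card N : ℚ_[p])⁻¹ • ∑ᶠ σ : N, MonoidAlgebra.of ℚ_[p] G (σ : G)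

/-- `Γ x = {y x | y ∈ Γ}`. -/
noncomputable def orderMul (Γ : Subalgebra ℤ_[p] (MonoidAlgebra ℚ_[p] G))
    (x : MonoidAlgebra ℚ_[p] G) : Submodule ℤ_[p] (MonoidAlgebra ℚ_[p] G) :=
  (Subalgebra.toSubmodule Γ).map (LinearMap.mulRight ℤ_[p] x)

/-- `ℤ_p[G]` is `N`-hybrid: `ℤ_p[G] = ℤ_p[G] e_N ⊕ 𝔐 (1 - e_N)` for some maximal `ℤ_p`-order `𝔐`
with `ℤ_p[G] ⊆ 𝔐 ⊆ ℚ_p[G]`. -/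
def IsHybrid (N : Subgroup G) : Prop :=
  ∃ M : Subalgebra ℤ_[p] (MonoidAlgebra ℚ_[p] G),
    IsMaximalPadicOrder p M ∧ integralGroupRing p G ≤ M ∧
    Disjoint (orderMul p (integralGroupRing p G) (traceIdempotent p N))
      (orderMul p M (1 - traceIdempotent p N)) ∧
    Subalgebra.toSubmodule (integralGroupRing p G) =
      orderMul p (integralGroupRing p G) (traceIdempotent p N) ⊔
        orderMul p M (1 - traceIdempotent p N)

end GroupRing

section Components

/-- A primitive central idempotent: a nonzero central idempotent `e` such that the only central
idempotents `f` with `f = f e` are `0` and `e`. -/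
structure IsPrimitiveCentralIdempotent {A : Type u} [Ring A] (e : A) : Prop where
  idem : IsIdempotentElem e
  central : e ∈ Subring.center A
  ne_zero : e ≠ 0
  primitive : ∀ f : A, IsIdempotentElem f → f ∈ Subring.center A → f * e = f → f = 0 ∨ f = e

/-- If `A` is an `R`-algebra then so is `e A e`, through `r ↦ r e`. -/
instance cornerAlgebra {R : Type*} {A : Type u} [CommRing R] [Ring A] [Algebra R A] {e : A}
    (he : IsIdempotentElem e) : Algebra R he.Corner where
  smul r x := ⟨r • x.1, by
    obtain ⟨y, hy⟩ := x.2
    exact ⟨r • y, by simp [← hy]⟩⟩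
  algebraMap :=
    { toFun := fun r => ⟨r • e, r • e, by simp [he.eq]⟩
      map_one' := Subtype.ext (one_smul R e)
      map_mul' := fun r s => Subtype.ext (by
        change (r * s) • e = (r • e) * (s • e)
        simp [he.eq, mul_smul, smul_comm r s])
      map_zero' := Subtype.ext (zero_smul R e)
      map_add' := fun r s => Subtype.ext (add_smul r s e) }
  commutes' r x := Subtype.ext (by
    change (r • e) * x.1 = x.1 * (r • e)
    have hx := (Subsemigroup.mem_corner_iff he).mp x.2
    simp [hx.1, hx.2])
  smul_def' r x := Subtype.ext (by
    change r • x.1 = (r • e) * x.1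
    have hx := (Subsemigroup.mem_corner_iff he).mp x.2
    simp [hx.1])

variable (p : ℕ) [Fact p.Prime] {G : Type u} [Group G]

/-- The primitive central idempotents `e` of `ℚ_p[G]` with `e e_N = 0`. For finite `G` there are
only finitely many, as `ℚ_p[G]` is finite-dimensional. -/
def HybridIndex (N : Subgroup G) : Type u :=
  {e : MonoidAlgebra ℚ_[p] G // IsPrimitiveCentralIdempotent e ∧ e * traceIdempotent p N = 0}

variable {p}

/-- The simple component `ℚ_p[G] e = e ℚ_p[G] e` of `ℚ_p[G]`, with identity element `e`. -/
def HybridIndex.Component {N : Subgroup G} (i : HybridIndex p N) : Type u :=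
  i.2.1.idem.Corner

noncomputable instance {N : Subgroup G} (i : HybridIndex p N) : Ring i.Component :=
  inferInstanceAs (Ring i.2.1.idem.Corner)

noncomputable instance {N : Subgroup G} (i : HybridIndex p N) : Algebra ℚ_[p] i.Component :=
  cornerAlgebra i.2.1.idem

/-- The centre `F` of the simple component `ℚ_p[G] e`, an extension field of `ℚ_p`. -/
def HybridIndex.CentreField {N : Subgroup G} (i : HybridIndex p N) : Type u :=
  Subalgebra.center ℚ_[p] i.Component

noncomputable instance {N : Subgroup G} (i : HybridIndex p N) : CommRing i.CentreField :=
  inferInstanceAs (CommRing (Subalgebra.center ℚ_[p] i.Component))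

noncomputable instance {N : Subgroup G} (i : HybridIndex p N) : Algebra ℚ_[p] i.CentreField :=
  inferInstanceAs (Algebra ℚ_[p] (Subalgebra.center ℚ_[p] i.Component))

noncomputable instance {N : Subgroup G} (i : HybridIndex p N) : Algebra ℤ_[p] i.CentreField :=
  Algebra.compHom i.CentreField (algebraMap ℤ_[p] ℚ_[p])

instance {N : Subgroup G} (i : HybridIndex p N) :
    IsScalarTower ℤ_[p] ℚ_[p] i.CentreField :=
  IsScalarTower.of_algebraMap_eq fun _ => rfl

/-- The ring of integers of `F`: the integral closure of `ℤ_p` in `F`. -/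
abbrev HybridIndex.RingOfIntegers {N : Subgroup G} (i : HybridIndex p N) : Type u :=
  integralClosure ℤ_[p] i.CentreField

end Components

/-! ### Frobenius groups: centralizers of kernel elements. -/

namespace IsFrobeniusComplement

variable {G : Type u} [Group G] {H N : Subgroup G}

/-! Everything rests on one fact: `1 - e_N` is a conjugation trace `∑ g w g⁻¹` with `w` in `ℤ_p[G]`.
In a Frobenius group the centralizer of a nontrivial kernel element lies in `N`, so its order is
prime to `p`, and class sums in `N \ {1}` are traces with `p`-integral coefficients
(`exists_sum_conj_eq_sum`, `IsFrobeniusKernel.exists_sum_conj_eq`).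

The linear trace of `y ↦ x y w` on `ℚ_p[G]` is the coefficient at `1` of `x ∑ g w g⁻¹`, and a map
preserving a lattice has integral trace. Hence `x (1 - e_N)` lies in `ℤ_p[G]` whenever `x` lies in
an order containing `ℤ_p[G]`, or is central and integral. The first case is the hybrid property. The
second puts the idempotents `e ∈ J` into `ℤ_p[G]` and makes the centre of each component order
integrally closed.

Let `B` be the image of `ℤ_p[G]` in a component. There `1` is a trace, so a Maschke argument makes
`B/pB` semisimple, and central elements of `B/pB` lift to central elements. Since `B` has no
nontrivial central idempotents, `B/pB` is a matrix ring over a finite field. Lifting matrix units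
gives `B` as a matrix ring over its centre; tensoring is replaced by using the same units in the
rational component. Perfectness of the residue field makes the centre unramified. -/

theorem not_commute (hH : IsFrobeniusComplement H) (hNH : N.IsComplement' H) {h n : G}
    (hh : h ∈ H) (h1 : h ≠ 1) (hn : n ∈ N) (n1 : n ≠ 1) : ¬ Commute h n := by
  intro hc
  have hnH : n ∉ H := fun hnH => n1 (Subgroup.disjoint_def.mp hNH.disjoint hn hnH)
  have := hH.inf_conj n hnH
  have hmem : h ∈ H ⊓ H.map (MulAut.conj n).toMonoidHom := by
    refine ⟨hh, h, hh, ?_⟩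
    simp [← hc.eq]
  rw [this] at hmem
  exact h1 hmem

/-- Write `g = n₀ h` with `h ≠ 1` in `H`. Since `h` commutes with no nontrivial element of `N`, the
map `n ↦ n (h n⁻¹ h⁻¹)` is injective on the finite set `N`, so it takes the value `n₀`; then `n h
n⁻¹ = g`. -/
theorem exists_conj_mem [Finite G] [N.Normal] (hH : IsFrobeniusComplement H)
    (hNH : N.IsComplement' H) {g : G} (hg : g ∉ N) : ∃ n ∈ N, n⁻¹ * g * n ∈ H := by
  obtain ⟨⟨n₀, h⟩, rfl⟩ := hNH.2 g
  have hh1 : (h : G) ≠ 1 := by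
    rintro h1
    exact hg (by simp [h1])
  let f : N → N := fun n => ⟨n * (h * n⁻¹ * h⁻¹), N.mul_mem n.2
    (Subgroup.Normal.conj_mem ‹_› _ (N.inv_mem n.2) _)⟩
  have hf : Function.Injective f := by
    intro a b hab
    have hab' : (a : G) * (h * a⁻¹ * h⁻¹) = b * (h * b⁻¹ * h⁻¹) := congrArg Subtype.val hab
    by_contra hne
    refine not_commute hH hNH h.2 hh1 (N.mul_mem (N.inv_mem b.2) a.2) ?_ ?_
    · intro h1
      exact hne (Subtype.ext (inv_mul_eq_one.mp h1).symm)
    · have h2 : (a : G) * h * a⁻¹ = b * h * b⁻¹ := by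
        simpa [mul_assoc] using congrArg (· * (h : G)) hab'
      have h3 : (a : G) * h = b * h * b⁻¹ * a := by rw [← h2]; simp
      change (h : G) * ((b : G)⁻¹ * a) = (b : G)⁻¹ * a * h
      rw [mul_assoc, h3]
      simp [mul_assoc]
  obtain ⟨n, hn⟩ := (Finite.injective_iff_surjective.mp hf) n₀
  refine ⟨n, n.2, ?_⟩
  have hn' : (n : G) * (h * n⁻¹ * h⁻¹) = n₀ := congrArg Subtype.val hn
  have : (n : G)⁻¹ * (n₀ * h) * n = h := by rw [← hn']; simp [mul_assoc]
  simp [this]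

/-- An element outside `N` is conjugate under `N` to a nontrivial element of `H`. If it commuted
with `n`, that conjugate would commute with a nontrivial element of `N`. -/
theorem centralizer_le [Finite G] [N.Normal] (hH : IsFrobeniusComplement H)
    (hNH : N.IsComplement' H) {n : G} (hn : n ∈ N) (n1 : n ≠ 1) :
    Subgroup.centralizer {n} ≤ N := by
  intro g hg
  by_contra hgN
  obtain ⟨m, hm, hmH⟩ := exists_conj_mem hH hNH hgN
  have hgn : n * g = g * n := (Subgroup.mem_centralizer_singleton_iff.mp hg).symm
  refine not_commute hH hNH hmH ?_ (Subgroup.Normal.conj_mem ‹_› n hn m⁻¹) ?_ ?_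
  · intro h1
    apply hgN
    have : g = 1 := by simpa [mul_assoc, inv_mul_eq_one, eq_comm] using h1
    exact this ▸ N.one_mem
  · simpa [mul_assoc, inv_mul_eq_one] using n1
  · change m⁻¹ * g * m * (m⁻¹ * n * m⁻¹⁻¹) = m⁻¹ * n * m⁻¹⁻¹ * (m⁻¹ * g * m)
    have : m⁻¹ * (n * g) * m = m⁻¹ * (g * n) * m := by rw [hgn]
    simpa [mul_assoc] using this.symm

end IsFrobeniusComplement

/-! ### Conjugation traces in group rings. -/

section ConjTrace

variable {G : Type u} [Group G] [Fintype G]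

theorem card_filter_conj_eq [DecidableEq G] (r x : G) (h : IsConj r x) :
    (Finset.univ.filter fun g : G => g * r * g⁻¹ = x).card =
      Nat.card (Subgroup.centralizer {r}) := by
  obtain ⟨c, rfl⟩ := isConj_iff.mp h
  rw [← Nat.subtype_card (p := fun g : G => g * r * g⁻¹ = c * r * c⁻¹) _ (by simp)]
  refine Nat.card_congr ((Equiv.mulLeft c⁻¹).subtypeEquiv fun g => ?_)
  rw [Subgroup.mem_centralizer_singleton_iff]
  simp only [Equiv.coe_mulLeft]
  constructor
  · intro hg
    have : c⁻¹ * (g * r * g⁻¹) * g = c⁻¹ * (c * r * c⁻¹) * g := by rw [hg]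
    simpa [mul_assoc] using this
  · intro hg
    have : c * (c⁻¹ * g * r) * g⁻¹ = c * (r * (c⁻¹ * g)) * g⁻¹ := by rw [hg]
    simpa [mul_assoc] using this

/-- A sum over a conjugation invariant set on which all centralizers have invertible order is a
trace from the trivial subgroup. -/
theorem exists_sum_conj_eq_sum {k : Type*} [CommRing k] (S : Finset G)
    (hS : ∀ x ∈ S, ∀ g : G, g * x * g⁻¹ ∈ S)
    (hk : ∀ x ∈ S, IsUnit (Nat.card (Subgroup.centralizer {x}) : k)) :
    ∃ w : MonoidAlgebra k G,
      ∑ g : G, MonoidAlgebra.of k G g * w * MonoidAlgebra.of k G g⁻¹ =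
        ∑ x ∈ S, MonoidAlgebra.of k G x := by
  classical
  induction hn : S.card using Nat.strong_induction_on generalizing S with
  | _ n ih =>
    obtain rfl | ⟨r, hr⟩ := S.eq_empty_or_nonempty
    · exact ⟨0, by simp⟩
    set C := S.filter fun x => IsConj r x with hC
    set S' := S.filter fun x => ¬ IsConj r x with hS'
    have hcard : S'.card < n := by
      rw [← hn]
      exact Finset.card_lt_card (Finset.filter_ssubset.mpr ⟨r, hr, not_not.mpr (IsConj.refl r)⟩)
    obtain ⟨w, hw⟩ := ih _ hcard S' (by
      intro x hx g
      rw [hS', Finset.mem_filter] at hx ⊢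
      refine ⟨hS x hx.1 g, fun h => hx.2 (h.trans ?_)⟩
      exact (isConj_iff.mpr ⟨g, rfl⟩ : IsConj x _).symm) (by
      intro x hx
      exact hk x (Finset.mem_filter.mp hx).1) rfl
    obtain ⟨c, hc⟩ := hk r hr
    -- The trace of `r` hits each element of its class exactly `c = |C_G(r)|` times, whence the
    -- factor `c⁻¹`.
    refine ⟨w + (↑c⁻¹ : k) • MonoidAlgebra.of k G r, ?_⟩
    rw [← Finset.sum_filter_add_sum_filter_not S (fun x => IsConj r x), ← hS', ← hw, ← hC]
    simp only [mul_add, add_mul, Finset.sum_add_distrib]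
    rw [add_comm]
    congr 1
    simp only [mul_smul_comm, smul_mul_assoc, ← Finset.smul_sum, ← map_mul]
    have : ∀ g ∈ (Finset.univ : Finset G), g * r * g⁻¹ ∈ C := by
      intro g _
      rw [hC, Finset.mem_filter]
      exact ⟨hS r hr g, isConj_iff.mpr ⟨g, rfl⟩⟩
    rw [← Finset.sum_fiberwise_of_maps_to this, Finset.smul_sum]
    refine Finset.sum_congr rfl fun x hx => ?_
    rw [Finset.sum_congr rfl (g := fun _ => MonoidAlgebra.of k G x)
      (fun g hg => by rw [(Finset.mem_filter.mp hg).2]), Finset.sum_const,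
      card_filter_conj_eq r x (Finset.mem_filter.mp hx).2, ← Nat.cast_smul_eq_nsmul k, smul_smul,
      ← hc, Units.inv_mul, one_smul]

end ConjTrace

/-- Centralizer orders of elements of `N \ {1}` divide `|N|`, hence are units, so `∑_{x ∈ N, x ≠ 1}
x` is the trace of some `w`. It remains to see that `|N| - 1` is a trace without inverting `|G|`. -/
theorem IsFrobeniusKernel.exists_sum_conj_eq {G : Type u} [Group G] [Fintype G] {N : Subgroup G}
    (hN : IsFrobeniusKernel N) {k : Type*} [CommRing k] (c : k) (hc : c * Nat.card N = 1) :
    ∃ w : MonoidAlgebra k G,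
      ∑ g : G, MonoidAlgebra.of k G g * w * MonoidAlgebra.of k G g⁻¹ =
        1 - c • ∑ᶠ σ : N, MonoidAlgebra.of k G (σ : G) := by
  classical
  have := hN.normal
  obtain ⟨H, hH, hNH⟩ := hN.exists_complement
  set S : Finset G := Finset.univ.filter fun x => x ∈ N ∧ x ≠ 1
  obtain ⟨w, hw⟩ := exists_sum_conj_eq_sum (k := k) S (by
    intro x hx g
    simp only [S, Finset.mem_filter, Finset.mem_univ, true_and] at hx ⊢
    exact ⟨this.conj_mem x hx.1 g, by simpa using hx.2⟩) (by
    intro x hx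
    simp only [S, Finset.mem_filter, Finset.mem_univ, true_and] at hx
    obtain ⟨d, hd⟩ := Subgroup.card_dvd_of_le (hH.centralizer_le hNH hx.1 hx.2)
    refine IsUnit.of_mul_eq_one (c * d) ?_
    rw [mul_left_comm, ← Nat.cast_mul, ← hd, hc])
  let ε : MonoidAlgebra k G →ₐ[k] k := MonoidAlgebra.lift k k G 1
  have hε : ∀ g, ε (MonoidAlgebra.of k G g) = 1 := fun g => by simp [ε]
  have hsum : ∑ᶠ σ : N, MonoidAlgebra.of k G (σ : G) = 1 + ∑ x ∈ S, MonoidAlgebra.of k G x := by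
    rw [finsum_eq_sum_of_fintype, ← Finset.sum_subtype (Finset.univ.filter fun x => x ∈ N)
      (by simp) (fun x => MonoidAlgebra.of k G x), ← Finset.add_sum_erase _ _ (a := 1) (by simp),
      map_one]
    congr 2
    ext x
    simp [S, and_comm]
  have haug : (Fintype.card G : k) * ε w = Nat.card N - 1 := by
    have h1 := congrArg ε hw
    have h2 := congrArg ε hsum
    rw [finsum_eq_sum_of_fintype] at h2
    simp only [map_sum, map_mul, map_add, map_one, hε, one_mul, mul_one, Finset.sum_const,
      nsmul_eq_mul, Finset.card_univ] at h1 h2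
    rw [h1, Nat.card_eq_fintype_card, h2]
    ring
  -- By augmentation, `|G| ε(w) = |N| - 1`, so the scalar `ε(w)` has trace `|N| - 1`.
  refine ⟨c • (ε w • 1 - w), ?_⟩
  rw [hsum, ← hw]
  simp only [mul_smul_comm, smul_mul_assoc, mul_sub, sub_mul, ← Finset.smul_sum,
    Finset.sum_sub_distrib, mul_one, ← map_mul, mul_inv_cancel, map_one, Finset.sum_const,
    Finset.card_univ, smul_sub, smul_add]
  rw [← Nat.cast_smul_eq_nsmul k, smul_smul, smul_smul, mul_assoc c, mul_comm (ε w), haug,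
    mul_sub, hc, sub_smul, one_smul, mul_one]
  abel

/-! ### Limits in finite `ℤ_p`-modules. -/

section PadicLimits

variable {p : ℕ} [Fact p.Prime] {B : Type*} [AddCommGroup B] [Module ℤ_[p] B]
  [Module.Finite ℤ_[p] B]

/-- Completeness without a topology on `B`: the series `∑ p^k t_k` is summed in `ℤ_p^m` and pushed
through a surjection onto `B`; its tails give the remainders `y`. -/
theorem PadicInt.exists_forall_eq_add_pow_smul (s t : ℕ → B)
    (h : ∀ n, s (n + 1) = s n + (p : ℤ_[p]) ^ n • t n) :
    ∃ l : B, ∀ n, ∃ y : B, l = s n + (p : ℤ_[p]) ^ n • y := by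
  obtain ⟨m, π, hπ⟩ := Module.Finite.exists_fin' ℤ_[p] B
  choose τ hτ using fun n => hπ (t n)
  have hp1 : ‖(p : ℤ_[p])‖ < 1 := by
    simpa using (PadicInt.norm_lt_one_iff_dvd (p : ℤ_[p])).mpr dvd_rfl
  have hsum : ∀ n, Summable fun k => (p : ℤ_[p]) ^ k • τ (n + k) := by
    intro n
    rw [Pi.summable]
    intro j
    refine Summable.of_norm_bounded (summable_geometric_of_lt_one (norm_nonneg _) hp1) ?_
    intro k
    simp only [Pi.smul_apply, smul_eq_mul, norm_mul, norm_pow]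
    exact mul_le_of_le_one_right (by positivity) (PadicInt.norm_le_one _)
  refine ⟨s 0 + π (∑' k, (p : ℤ_[p]) ^ k • τ (0 + k)), fun n =>
    ⟨π (∑' k, (p : ℤ_[p]) ^ k • τ (n + k)), ?_⟩⟩
  induction n with
  | zero => simp
  | succ n ih =>
    have key : ∑' k, (p : ℤ_[p]) ^ k • τ (n + k) =
        τ n + (p : ℤ_[p]) • ∑' k, (p : ℤ_[p]) ^ k • τ (n + 1 + k) := by
      rw [(hsum n).tsum_eq_zero_add, ← (hsum (n + 1)).tsum_const_smul]
      simp only [pow_zero, add_zero, one_smul, smul_smul, pow_succ']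
      congr 2
      ext1 k
      rw [add_assoc, add_comm 1 k]
    rw [ih, key, h, map_add, map_smul, hτ, smul_add, smul_smul, pow_succ, add_assoc]

theorem PadicInt.eq_zero_of_forall_eq_pow_smul {x : B}
    (h : ∀ n, ∃ y : B, x = (p : ℤ_[p]) ^ n • y) : x = 0 := by
  have := Ideal.iInf_pow_smul_eq_bot_of_isLocalRing (M := B) (IsLocalRing.maximalIdeal ℤ_[p])
    (IsLocalRing.maximalIdeal.isMaximal _).ne_top
  rw [← Submodule.mem_bot ℤ_[p], ← this, Submodule.mem_iInf]
  intro n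
  obtain ⟨y, rfl⟩ := h n
  refine Submodule.smul_mem_smul (Ideal.pow_mem_pow ?_ n) trivial
  rw [PadicInt.maximalIdeal_eq_span_p]
  exact Ideal.mem_span_singleton_self _

end PadicLimits

/-! ### Idempotents and units modulo `p`. -/

section FiniteAlgebra

variable {p : ℕ} [Fact p.Prime] {B : Type*} [Ring B] [Algebra ℤ_[p] B] [Module.Finite ℤ_[p] B]

theorem PadicInt.pow_smul_eq_pow_mul {B : Type*} [Ring B] [Algebra ℤ_[p] B] (n : ℕ) (x : B) :
    (p : ℤ_[p]) ^ n • x = (p : B) ^ n * x := by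
  rw [Algebra.smul_def, map_pow, map_natCast]

/-- If `f = p y`, then `f = f^n f = p^n y^n f` for all `n`. -/
theorem IsIdempotentElem.eq_zero_of_natCast_dvd {f : B} (hf : IsIdempotentElem f)
    (h : (p : B) ∣ f) : f = 0 := by
  refine PadicInt.eq_zero_of_forall_eq_pow_smul (p := p) fun n => ?_
  simp only [PadicInt.pow_smul_eq_pow_mul]
  obtain ⟨y, hy⟩ := h
  refine ⟨y ^ n * f, ?_⟩
  rw [← mul_assoc, ← (Nat.cast_commute p y).mul_pow, ← hy]
  induction n with
  | zero => simp
  | succ n ih => rw [pow_succ, mul_assoc, hf.eq, ← ih]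

theorem exists_isIdempotentElem_natCast_dvd_sub {b : B} (h : (p : B) ∣ b * b - b) :
    ∃ f : B, IsIdempotentElem f ∧ (p : B) ∣ f - b := by
  -- Newton iteration for `x² = x`. The new defect is the square of the old one times `4x² - 4x -
  -- 3`, and the increment is the defect times `1 - 2x`. Divisibility of the `n`th defect by
  -- `p^(n+1)` suffices.
  let s : ℕ → B := fun n => (fun x => 3 * x ^ 2 - 2 * x ^ 3)^[n] b
  have hs0 : s 0 = b := rfl
  have hs : ∀ n, s (n + 1) = 3 * s n ^ 2 - 2 * s n ^ 3 := fun n =>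
    Function.iterate_succ_apply' _ _ _
  have comm : ∀ (n : ℕ) (y : B), Commute ((p : B) ^ n) y := fun n y =>
    (Nat.cast_commute p y).pow_left n
  have key : ∀ n, ∃ y, s n * s n - s n = (p : B) ^ (n + 1) * y := by
    intro n
    induction n with
    | zero => obtain ⟨y, hy⟩ := h; exact ⟨y, by simpa [hs0] using hy⟩
    | succ n ih =>
      obtain ⟨y, hy⟩ := ih
      refine ⟨p ^ n * (y * y * (4 * s n ^ 2 - 4 * s n - 3)), ?_⟩
      have h1 : s (n + 1) * s (n + 1) - s (n + 1) =
          (s n * s n - s n) * (s n * s n - s n) * (4 * s n ^ 2 - 4 * s n - 3) := by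
        rw [hs]; noncomm_ring
      rw [h1, hy, ← mul_assoc ((p : B) ^ (n + 1 + 1)), ← pow_add, mul_assoc ((p : B) ^ (n + 1)) y,
        ← mul_assoc y, ← (comm (n + 1) y).eq, ← mul_assoc, ← mul_assoc, ← pow_add]
      have : n + 1 + (n + 1) = n + 1 + 1 + n := by ring
      rw [this, mul_assoc _ y y, mul_assoc, mul_assoc]
  choose y hy using key
  obtain ⟨l, hl⟩ := PadicInt.exists_forall_eq_add_pow_smul (p := p) s
    (fun n => p * (y n * (1 - 2 * s n))) (by
      intro n
      rw [PadicInt.pow_smul_eq_pow_mul, ← mul_assoc, ← pow_succ, ← mul_assoc, ← hy, hs]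
      noncomm_ring)
  simp only [PadicInt.pow_smul_eq_pow_mul] at hl
  refine ⟨l, ?_, ?_⟩
  · rw [IsIdempotentElem, ← sub_eq_zero]
    refine PadicInt.eq_zero_of_forall_eq_pow_smul (p := p) fun n => ?_
    simp only [PadicInt.pow_smul_eq_pow_mul]
    obtain ⟨z, hz⟩ := hl n
    refine ⟨p * y n + s n * z + z * s n + z * (p ^ n * z) - z, ?_⟩
    have h1 : s n * ((p : B) ^ n * z) = p ^ n * (s n * z) := by
      rw [← mul_assoc, ← (comm n (s n)).eq, mul_assoc]
    have h2 := hy n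
    rw [sub_eq_iff_eq_add] at h2
    rw [hz]
    simp only [mul_add, add_mul, h1, h2, mul_sub, pow_succ, mul_assoc]
    abel
  · obtain ⟨z, hz⟩ := hl 1
    refine ⟨z + y 0 * (1 - 2 * s 0), ?_⟩
    rw [hz, hs, mul_add, ← mul_assoc (p : B) (y 0)]
    have := hy 0
    rw [zero_add, pow_one] at this
    rw [← this, hs0, pow_one]
    noncomm_ring

/-- Multiplication by `z` is surjective modulo `p`, hence surjective by Nakayama. -/
theorem isUnit_of_natCast_dvd_mul_sub_one {C : Type*} [CommRing C] [Algebra ℤ_[p] C]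
    [Module.Finite ℤ_[p] C] {z y : C} (h : (p : C) ∣ z * y - 1) : IsUnit z := by
  obtain ⟨t, ht⟩ := h
  have : (⊤ : Submodule ℤ_[p] C) ≤ LinearMap.range (LinearMap.mulLeft ℤ_[p] z) := by
    refine Submodule.le_of_le_smul_of_le_jacobson_bot (I := IsLocalRing.maximalIdeal ℤ_[p])
      Module.Finite.fg_top (IsLocalRing.jacobson_eq_maximalIdeal _ bot_ne_top).ge ?_
    intro x _
    have hx : x = z * (y * x) + (p : ℤ_[p]) • (-(t * x)) := by
      have := PadicInt.pow_smul_eq_pow_mul (p := p) 1 (-(t * x))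
      rw [pow_one, pow_one] at this
      rw [this]
      linear_combination -x * ht
    rw [hx]
    refine Submodule.add_mem_sup ⟨y * x, rfl⟩ (Submodule.smul_mem_smul ?_ trivial)
    rw [PadicInt.maximalIdeal_eq_span_p]
    exact Ideal.mem_span_singleton_self _
  obtain ⟨x, hx⟩ := this (x := 1) trivial
  exact IsUnit.of_mul_eq_one x hx

end FiniteAlgebra

/-! ### Central traces and semisimplicity. -/

section ConjTraceRing

theorem sum_conj_mem_center {k R G : Type*} [CommRing k] [Ring R] [Algebra k R] [Group G]
    [Fintype G] (u : G →* R) (hu : Submodule.span k (Set.range u) = ⊤) (x : R) :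
    ∑ g, u g * x * u g⁻¹ ∈ Subring.center R := by
  rw [Subring.mem_center_iff]
  intro r
  have hr : r ∈ Submodule.span k (Set.range u) := hu ▸ trivial
  induction hr using Submodule.span_induction with
  | mem r hr =>
    obtain ⟨h, rfl⟩ := hr
    rw [Finset.mul_sum, Finset.sum_mul, ← Equiv.sum_comp (Equiv.mulLeft h)
      (fun g => u g * x * u g⁻¹ * u h)]
    refine Finset.sum_congr rfl fun g _ => ?_
    simp only [Equiv.coe_mulLeft, mul_inv_rev, map_mul, mul_assoc]
    rw [← map_mul u h⁻¹ h, inv_mul_cancel, map_one, mul_one]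
  | zero => simp
  | add a b _ _ ha hb => rw [add_mul, mul_add, ha, hb]
  | smul c a _ ha => rw [smul_mul_assoc, mul_smul_comm, ha]

/-- A form of Maschke's theorem: if `1` is a trace then the algebra spanned by the group is
semisimple. -/
theorem isSemisimpleRing_of_sum_conj_eq_one {k R G : Type*} [Field k] [Ring R] [Algebra k R]
    [Group G] [Fintype G] (u : G →* R) (hu : Submodule.span k (Set.range u) = ⊤) (w : R)
    (hw : ∑ g, u g * w * u g⁻¹ = 1) : IsSemisimpleRing R := by
  refine (isSemisimpleModule_iff R R).mpr ⟨fun I => ?_⟩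
  obtain ⟨π, hπ⟩ := (I.restrictScalars k).subtype.exists_leftInverse_of_injective
    (LinearMap.ker_eq_bot.mpr Subtype.val_injective)
  replace hπ : ∀ x (hx : x ∈ I), (π x : R) = x := fun x hx =>
    congrArg Subtype.val (LinearMap.congr_fun hπ ⟨x, hx⟩)
  -- The averaged projection, with `w` inserted in place of division by the group order.
  let q : R →ₗ[k] R := ∑ g, LinearMap.mulLeft k (u g * w) ∘ₗ (I.restrictScalars k).subtype ∘ₗ π ∘ₗ
    LinearMap.mulLeft k (u g⁻¹)
  have hq : ∀ x, q x = ∑ g, u g * w * (π (u g⁻¹ * x) : R) := fun x => by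
    simp [q, mul_assoc]
  have hqI : ∀ x, q x ∈ I := fun x => by
    rw [hq]
    exact Submodule.sum_mem _ fun g _ => I.smul_mem _ (π (u g⁻¹ * x)).2
  have hqid : ∀ x ∈ I, q x = x := fun x hx => by
    rw [hq]
    calc _ = ∑ g, u g * w * u g⁻¹ * x := Finset.sum_congr rfl fun g _ => by
            rw [hπ (u g⁻¹ * x) (I.smul_mem (u g⁻¹) hx), mul_assoc _ (u g⁻¹)]
      _ = x := by rw [← Finset.sum_mul, hw, one_mul]
  have hql : ∀ r x, q (r * x) = r * q x := fun r x => by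
    have hr : r ∈ Submodule.span k (Set.range u) := hu ▸ trivial
    induction hr using Submodule.span_induction with
    | mem r hr =>
      obtain ⟨h, rfl⟩ := hr
      rw [hq, hq, Finset.mul_sum, ← Equiv.sum_comp (Equiv.mulLeft h)]
      refine Finset.sum_congr rfl fun g _ => ?_
      simp only [Equiv.coe_mulLeft, mul_inv_rev, map_mul, mul_assoc]
      rw [← mul_assoc (u h⁻¹), ← map_mul u h⁻¹ h, inv_mul_cancel, map_one, one_mul]
    | zero => simp
    | add a b _ _ ha hb => rw [add_mul, map_add, ha, hb, add_mul]
    | smul c a _ ha => rw [smul_mul_assoc, map_smul, ha, smul_mul_assoc]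
  let f : R →ₗ[R] I :=
    { toFun := fun x => ⟨q x, hqI x⟩
      map_add' := fun x y => Subtype.ext (map_add q x y)
      map_smul' := fun r x => Subtype.ext (hql r x) }
  exact ⟨LinearMap.ker f, LinearMap.isCompl_of_proj fun x => Subtype.ext (hqid x x.2)⟩

end ConjTraceRing

/-! ### The residue ring modulo `p`. -/

section Residue

theorem finite_center {p : ℕ} [Fact p.Prime] {B : Type*} [Ring B] [Algebra ℤ_[p] B]
    [Module.Finite ℤ_[p] B] : Module.Finite ℤ_[p] (Subalgebra.center ℤ_[p] B) :=
  Module.Finite.of_injective (Subalgebra.center ℤ_[p] B).val.toLinearMap Subtype.val_injective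

/-- If `z = n x` is central, then `z = ∑ g w g⁻¹ z = n ∑ g (w x) g⁻¹`, and the last sum is central
although `x` need not be. -/
theorem exists_mem_center_eq_natCast_mul {k B G : Type*} [CommRing k] [Ring B] [Algebra k B]
    [Group G] [Fintype G] (u : G →* B) (hu : Submodule.span k (Set.range u) = ⊤) {w : B}
    (hw : ∑ g, u g * w * u g⁻¹ = 1) {n : ℕ} {z : B} (hz : z ∈ Subring.center B)
    (h : (n : B) ∣ z) : ∃ y ∈ Subring.center B, z = n * y := by
  obtain ⟨x, hx⟩ := h
  refine ⟨_, sum_conj_mem_center u hu (w * x), ?_⟩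
  rw [Subring.mem_center_iff] at hz
  calc z = ∑ g, u g * w * u g⁻¹ * z := by rw [← Finset.sum_mul, hw, one_mul]
    _ = _ := by
      rw [Finset.mul_sum]
      refine Finset.sum_congr rfl fun g _ => ?_
      rw [mul_assoc _ _ z, hz, hx, ← mul_assoc (u g) w x, mul_assoc (u g * w) x,
        ← mul_assoc (n : B), (Nat.cast_commute n (u g * w)).eq]
      simp only [mul_assoc]

/-- The residue ring of an indecomposable finite `ℤ_p`-algebra in which `1` is a trace is a full
matrix ring over a finite field, and its centre lifts. -/
theorem exists_surjective_matrix_finite_field {p : ℕ} [Fact p.Prime] {B : Type u} [Ring B]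
    [Nontrivial B] [Algebra ℤ_[p] B] [Module.Finite ℤ_[p] B] {G : Type*} [Group G] [Fintype G]
    (u : G →* B) (hu : Submodule.span ℤ_[p] (Set.range u) = ⊤) (w : B)
    (hw : ∑ g, u g * w * u g⁻¹ = 1)
    (hconn : ∀ z ∈ Subring.center B, IsIdempotentElem z → z = 0 ∨ z = 1) :
    ∃ (D : Type u) (_ : Field D) (_ : Finite D) (d : ℕ) (_ : NeZero d)
      (Φ : B →+* Matrix (Fin d) (Fin d) D), Function.Surjective Φ ∧
      (∀ x, Φ x = 0 ↔ (p : B) ∣ x) ∧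
      ∀ s : D, ∃ c ∈ Subring.center B, Φ c = Matrix.scalar (Fin d) s := by
  classical
  let I : Ideal B := Ideal.span {(p : B)}
  have hI : I.IsTwoSided := ⟨fun {a} b ha => by
    obtain ⟨c, rfl⟩ := Ideal.mem_span_singleton'.mp ha
    exact Ideal.mem_span_singleton'.mpr ⟨c * b, by
      rw [mul_assoc, mul_assoc, (Nat.cast_commute p b).eq]⟩⟩
  let q : B →+* B ⧸ I := Ideal.Quotient.mk I
  have hqs : Function.Surjective q := Ideal.Quotient.mk_surjective
  have hq0 : ∀ x, q x = 0 ↔ (p : B) ∣ x := fun x => by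
    rw [Ideal.Quotient.eq_zero_iff_mem, Ideal.mem_span_singleton']
    exact ⟨fun ⟨a, ha⟩ => ⟨a, by rw [← ha, (Nat.cast_commute p a).eq]⟩,
      fun ⟨a, ha⟩ => ⟨a, by rw [ha, (Nat.cast_commute p a).eq]⟩⟩
  have hp0 : (p : B ⧸ I) = 0 := by
    rw [← map_natCast q, hq0]
  have hnt : Nontrivial (B ⧸ I) := by
    refine ⟨⟨1, 0, fun h => one_ne_zero (α := B) ?_⟩⟩
    rw [← map_one q, hq0] at h
    exact IsIdempotentElem.one.eq_zero_of_natCast_dvd h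
  have hchar : CharP (B ⧸ I) p :=
    ringChar.of_eq (CharP.ringChar_of_prime_eq_zero Fact.out hp0)
  let _ : Algebra (ZMod p) (B ⧸ I) := ZMod.algebra _ p
  let ū : G →* B ⧸ I := q.toMonoidHom.comp u
  have hū : Submodule.span (ZMod p) (Set.range ū) = ⊤ := by
    rw [eq_top_iff]
    rintro x -
    obtain ⟨x, rfl⟩ := hqs x
    have hx : x ∈ Submodule.span ℤ_[p] (Set.range u) := hu ▸ trivial
    induction hx using Submodule.span_induction with
    | mem r hr =>
      obtain ⟨g, rfl⟩ := hr
      exact Submodule.subset_span ⟨g, rfl⟩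
    | zero => simp
    | add a b _ _ ha hb => rw [map_add]; exact add_mem ha hb
    | smul c a _ ha =>
      obtain ⟨n, -, hn⟩ := PadicInt.exists_mem_range c
      rw [PadicInt.maximalIdeal_eq_span_p, Ideal.mem_span_singleton] at hn
      obtain ⟨d, hd⟩ := hn
      have : q (c • a) = (n : ℕ) • q a := by
        rw [← map_nsmul, ← sub_eq_zero, ← map_sub, hq0]
        refine ⟨d • a, ?_⟩
        rw [sub_eq_iff_eq_add] at hd
        rw [hd, add_smul, Nat.cast_smul_eq_nsmul, add_sub_cancel_right, mul_smul,
          Nat.cast_smul_eq_nsmul, nsmul_eq_mul]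
      rw [this]
      exact Submodule.smul_of_tower_mem _ n ha
  have hw' : ∑ g, ū g * q w * ū g⁻¹ = 1 := by
    rw [← map_one q, ← hw, map_sum]
    simp [ū]
  have hss : IsSemisimpleRing (B ⧸ I) := isSemisimpleRing_of_sum_conj_eq_one ū hū (q w) hw'
  have hmf : Module.Finite (ZMod p) (B ⧸ I) :=
    ⟨⟨(Set.finite_range ū).toFinset, by simpa using hū⟩⟩
  have hfin : Finite (B ⧸ I) := Module.finite_of_finite (ZMod p)
  -- For any lift `x` of `z`, the trace of `w x` is central and reduces to `z`.
  have hlift : ∀ z ∈ Subring.center (B ⧸ I), ∃ c ∈ Subring.center B, q c = z := by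
    intro z hz
    obtain ⟨x, rfl⟩ := hqs z
    refine ⟨_, sum_conj_mem_center u hu (w * x), ?_⟩
    rw [map_sum]
    calc _ = ∑ g, ū g * q w * ū g⁻¹ * q x := Finset.sum_congr rfl fun g _ => by
            rw [Subring.mem_center_iff] at hz
            simp only [map_mul, ū, mul_assoc]
            congr 2
            exact (hz _).symm
      _ = q x := by rw [← Finset.sum_mul, hw', one_mul]
  -- A central lift `c` has `c² - c` divisible by `p` within the centre, so the idempotent lifting
  -- can be carried out in the centre of `B`.
  have hconn' : ∀ z ∈ Subring.center (B ⧸ I), IsIdempotentElem z → z = 0 ∨ z = 1 := by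
    intro z hz hzi
    obtain ⟨c, hc, rfl⟩ := hlift z hz
    have hcc : (p : B) ∣ c * c - c := by
      rw [← hq0, map_sub, map_mul, hzi.eq, sub_self]
    obtain ⟨y, hy, hcy⟩ := exists_mem_center_eq_natCast_mul u hu hw
      (sub_mem (mul_mem hc hc) hc) hcc
    have := finite_center (p := p) (B := B)
    obtain ⟨⟨f, hfc⟩, hf, ⟨t, ht⟩⟩ := exists_isIdempotentElem_natCast_dvd_sub (p := p)
      (b := (⟨c, hc⟩ : Subalgebra.center ℤ_[p] B)) ⟨⟨y, hy⟩, Subtype.ext hcy⟩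
    have hft : f - c = p * t := congrArg Subtype.val ht
    have hqf : q f = q c := by
      rw [← sub_eq_zero, ← map_sub, hq0]
      exact ⟨t, hft⟩
    rw [← hqf]
    obtain rfl | rfl := hconn f hfc (congrArg Subtype.val hf)
    · exact Or.inl (map_zero q)
    · exact Or.inr (map_one q)
  obtain ⟨n, D, d, hD, hd, ⟨Ψ⟩⟩ :=
    IsSemisimpleRing.exists_ringEquiv_pi_matrix_divisionRing (R := B ⧸ I)
  have hn : n ≠ 0 := by
    rintro rfl
    exact one_ne_zero (Ψ.injective (Subsingleton.elim (Ψ 1) (Ψ 0)))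
  let i : Fin n := ⟨0, Nat.pos_of_ne_zero hn⟩
  -- The unit of one Wedderburn block is a nonzero central idempotent, hence `1`: there is only one
  -- block.
  have hsingle : Pi.single (M := fun i => Matrix (Fin (d i)) (Fin (d i)) (D i)) i 1 = 1 := by
    set ε := Pi.single (M := fun i => Matrix (Fin (d i)) (Fin (d i)) (D i)) i 1 with hε
    have hcomm : ∀ x, x * ε = ε * x := by
      intro x
      ext1 j
      obtain rfl | hj := eq_or_ne j i
      · simp [ε]
      · simp [ε, hj]
    have := hconn' (Ψ.symm ε) (by
      rw [Subring.mem_center_iff]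
      intro x
      apply Ψ.injective
      simp [hcomm]) (by
      rw [IsIdempotentElem, ← map_mul, ← Pi.single_mul, one_mul])
    obtain h | h := this
    · have h0 : ε = 0 := by simpa using h
      have := congrFun h0 i
      simp only [hε, Pi.single_eq_same, Pi.zero_apply] at this
      have := congrFun (congrFun this 0) 0
      simp at this
    · simpa using h
  have huniq : ∀ j, j = i := by
    intro j
    by_contra hj
    have := congrFun (congrFun (congrFun hsingle j) 0) 0
    simp [hj] at this
  let ev : (∀ i, Matrix (Fin (d i)) (Fin (d i)) (D i)) →+* Matrix (Fin (d i)) (Fin (d i)) (D i) :=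
    Pi.evalRingHom _ i
  have hev : Function.Injective ev := by
    intro a b hab
    ext1 j
    obtain rfl := huniq j
    exact hab
  have hevs : Function.Surjective ev := fun a => ⟨Pi.single i a, by simp [ev]⟩
  have hfD : Finite (D i) := by
    refine Finite.of_injective (fun x : D i => Ψ.symm (Pi.single i (Matrix.scalar (Fin (d i)) x))) ?_
    intro a b hab
    have := congrFun (congrFun (Pi.single_injective i (Ψ.symm.injective hab)) 0) 0
    simpa using this
  let _ : Field (D i) := littleWedderburn (D i)
  have hcenter : ∀ s : D i, ∃ c ∈ Subring.center B, (ev (Ψ (q c))) = Matrix.scalar (Fin (d i)) s := by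
    intro s
    obtain ⟨y, hy⟩ := hevs (Matrix.scalar (Fin (d i)) s)
    obtain ⟨c, hc, hcy⟩ := hlift (Ψ.symm y) (by
      rw [Subring.mem_center_iff]
      intro x
      apply Ψ.injective
      apply hev
      simp only [map_mul, RingEquiv.apply_symm_apply, hy]
      exact ((Matrix.scalar_commute s (fun r => mul_comm s r) _).eq).symm)
    exact ⟨c, hc, by rw [hcy, RingEquiv.apply_symm_apply, hy]⟩
  refine ⟨D i, inferInstance, hfD, d i, hd i, ev.comp (Ψ.toRingHom.comp q), ?_, ?_, ?_⟩
  · exact hevs.comp (Ψ.surjective.comp hqs)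
  · intro x
    rw [← hq0]
    simp only [RingHom.coe_comp, Function.comp_apply]
    rw [map_eq_zero_iff ev hev]
    exact map_eq_zero_iff Ψ Ψ.injective
  · exact hcenter

end Residue

/-! ### Matrix rings from matrix units. -/

section MatrixUnits

/-- A ring with matrix units `u a * v b`, where `v a * u b = δ_{ab} f` and `f A f = R f`, is a
matrix ring over `R`. -/
theorem nonempty_matrix_algEquiv_of_units {R A : Type*} [CommRing R] [Ring A] [Algebra R A]
    (hRA : ∀ r : R, r • (1 : A) = 0 → r = 0) {d : ℕ}
    (f : A) (u v : Fin d → A) (huf : ∀ a, u a * f = u a)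
    (hvu : ∀ a b, v a * u b = if a = b then f else 0) (huv : ∑ a, u a * v a = 1)
    (hf : ∀ x, ∃ r : R, f * x * f = r • f) :
    Nonempty (A ≃ₐ[R] Matrix (Fin d) (Fin d) R) := by
  have hinj : ∀ r : R, r • f = 0 → r = 0 := by
    intro r hr
    apply hRA
    rw [← huv, Finset.smul_sum]
    refine Finset.sum_eq_zero fun a _ => ?_
    rw [← huf a, ← smul_mul_assoc, ← mul_smul_comm, hr, mul_zero, zero_mul]
  have hvf : ∀ a, f * v a = v a := fun a => by
    calc f * v a = v a * u a * v a := by rw [hvu, if_pos rfl]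
      _ = ∑ b, v a * u b * v b := by
        rw [Finset.sum_eq_single a _ (by simp)]
        intro b _ hb
        rw [hvu, if_neg hb.symm, zero_mul]
      _ = v a := by simp_rw [mul_assoc, ← Finset.mul_sum, huv, mul_one]
  let ψ : Matrix (Fin d) (Fin d) R →ₗ[R] A :=
    { toFun := fun c => ∑ a, ∑ b, c a b • (u a * v b)
      map_add' := fun c c' => by simp [add_smul, Finset.sum_add_distrib]
      map_smul' := fun r c => by simp [mul_smul, Finset.smul_sum] }
  have hψ : ∀ c, ψ c = ∑ a, ∑ b, c a b • (u a * v b) := fun c => rfl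
  have hmul1 : ∀ c a, v a * ψ c = ∑ b, c a b • v b := by
    intro c a
    rw [hψ, Finset.mul_sum, Finset.sum_eq_single a _ (by simp)]
    · rw [Finset.mul_sum]
      refine Finset.sum_congr rfl fun b _ => ?_
      rw [mul_smul_comm, ← mul_assoc, hvu, if_pos rfl, hvf]
    · intro b _ hb
      rw [Finset.mul_sum]
      refine Finset.sum_eq_zero fun b' _ => ?_
      rw [mul_smul_comm, ← mul_assoc, hvu, if_neg hb.symm, zero_mul, smul_zero]
  have hentry : ∀ c a b, v a * ψ c * u b = c a b • f := by
    intro c a b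
    rw [hmul1, Finset.sum_mul, Finset.sum_eq_single b _ (by simp)]
    · rw [smul_mul_assoc, hvu, if_pos rfl]
    · intro b' _ hb
      rw [smul_mul_assoc, hvu, if_neg hb, smul_zero]
  have hone : ψ 1 = 1 := by
    rw [hψ, ← huv]
    refine Finset.sum_congr rfl fun a _ => ?_
    rw [Finset.sum_eq_single a _ (by simp)]
    · simp
    · intro b _ hb
      rw [Matrix.one_apply_ne hb.symm, zero_smul]
  have hmul : ∀ c c', ψ (c * c') = ψ c * ψ c' := by
    intro c c'
    rw [hψ c, Finset.sum_mul, hψ]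
    refine Finset.sum_congr rfl fun a _ => ?_
    rw [Finset.sum_mul]
    simp_rw [smul_mul_assoc, mul_assoc (u a), hmul1, Finset.mul_sum, Matrix.mul_apply,
      Finset.sum_smul, Finset.smul_sum]
    rw [Finset.sum_comm]
    simp_rw [mul_smul_comm, smul_smul]
  refine ⟨(AlgEquiv.ofBijective (AlgHom.ofLinearMap ψ hone hmul) ⟨?_, fun x => ?_⟩).symm⟩
  · rw [injective_iff_map_eq_zero]
    intro c hc
    replace hc : ψ c = 0 := hc
    ext a b
    apply hinj
    rw [← hentry, hc, mul_zero, zero_mul]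
  -- The entries of `x` are read off from the corner: `v a * x * u b` already lies in `f A f`.
  · choose r hr using fun a b => hf (v a * x * u b)
    refine ⟨Matrix.of r, ?_⟩
    change ψ _ = x
    calc ψ _ = ∑ a, ∑ b, u a * v a * x * (u b * v b) := by
          rw [hψ]
          refine Finset.sum_congr rfl fun a _ => Finset.sum_congr rfl fun b _ => ?_
          rw [Matrix.of_apply, ← huf a, mul_assoc (u a), hvf, ← smul_mul_assoc]
          have h1 : u b * f = u b := huf b
          have h2 : r a b • (u a * v b) = u a * (r a b • f) * v b := by
            rw [mul_smul_comm, huf, smul_mul_assoc]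
          rw [smul_mul_assoc, h2, ← hr]
          simp only [← mul_assoc]
          simp only [huf, mul_assoc]
      _ = x := by
          simp_rw [← Finset.mul_sum, huv, mul_one, ← Finset.sum_mul, huv, one_mul]

end MatrixUnits

/-! ### Lifting matrix units, and unramified centres. -/

section Lifting

variable {p : ℕ} [Fact p.Prime] {B : Type u} [Ring B] [Algebra ℤ_[p] B] [Module.Finite ℤ_[p] B]

theorem isUnit_det_of_natCast_dvd_sub_one {C : Type*} [CommRing C] [Algebra ℤ_[p] C]
    [Module.Finite ℤ_[p] C] {d : ℕ} {M : Matrix (Fin d) (Fin d) C}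
    (h : ∀ a b, (p : C) ∣ M a b - (1 : Matrix (Fin d) (Fin d) C) a b) : IsUnit M.det := by
  let I : Ideal C := Ideal.span {(p : C)}
  have hM : (Ideal.Quotient.mk I).mapMatrix M = (Ideal.Quotient.mk I).mapMatrix 1 := by
    ext a b
    exact Ideal.Quotient.eq.mpr (Ideal.mem_span_singleton.mpr (h a b))
  refine isUnit_of_natCast_dvd_mul_sub_one (p := p) (y := 1) ?_
  rw [mul_one, ← Ideal.mem_span_singleton]
  refine (Ideal.Quotient.eq (I := I)).mp ?_
  rw [RingHom.map_det, hM, map_one, Matrix.det_one, map_one]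

/-- Lifting matrix units from a residue matrix ring. -/
theorem exists_matrix_units_lift {D : Type*} [Field D] {d : ℕ} [NeZero d]
    (Φ : B →+* Matrix (Fin d) (Fin d) D) (hΦ : Function.Surjective Φ)
    (hΦ0 : ∀ x, Φ x = 0 ↔ (p : B) ∣ x)
    (hcen : ∀ s : D, ∃ c ∈ Subring.center B, Φ c = Matrix.scalar (Fin d) s)
    (hdiv : ∀ z ∈ Subring.center B, (p : B) ∣ z → ∃ y ∈ Subring.center B, z = p * y) :
    ∃ (f : B) (u v : Fin d → B), (∀ a, u a * f = u a) ∧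
      (∀ a b, v a * u b = if a = b then f else 0) ∧ ∑ a, u a * v a = 1 ∧
      ∀ x, ∃ r ∈ Subring.center B, f * x * f = r * f := by
  have hCfin := finite_center (p := p) (B := B)
  have hscal : ∀ (s t : D) (a b : Fin d), Matrix.scalar (Fin d) s * Matrix.single a b t =
      Matrix.single a b (s * t) := fun s t a b => by
    ext i j
    rw [Matrix.scalar_apply, Matrix.diagonal_mul]
    simp [Matrix.single_apply]
  obtain ⟨e, he⟩ := hΦ (Matrix.single 0 0 1)
  obtain ⟨f, hff, hfe⟩ := exists_isIdempotentElem_natCast_dvd_sub (p := p) (b := e) (by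
    rw [← hΦ0, map_sub, map_mul, he, Matrix.single_mul_single_same, mul_one, sub_self])
  have hΦf : Φ f = Matrix.single 0 0 1 := by
    rw [← hΦ0, map_sub, sub_eq_zero] at hfe
    rw [hfe, he]
  have hff' : f * f = f := hff
  -- Modulo `p` the corner consists of scalars times `f`, and scalars lift to the centre; Nakayama
  -- then gives `f B f = Z(B) f`.
  have hcorner : ∀ x, ∃ r ∈ Subring.center B, f * x * f = r * f := by
    let N' : Submodule ℤ_[p] B :=
      LinearMap.range (LinearMap.mulRight ℤ_[p] f ∘ₗ LinearMap.mulLeft ℤ_[p] f)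
    let N : Submodule ℤ_[p] B :=
      (Subalgebra.toSubmodule (Subalgebra.center ℤ_[p] B)).map (LinearMap.mulRight ℤ_[p] f)
    have hN : N' ≤ N := by
      refine Submodule.le_of_le_smul_of_le_jacobson_bot (I := IsLocalRing.maximalIdeal ℤ_[p])
        (IsNoetherian.noetherian N') (IsLocalRing.jacobson_eq_maximalIdeal _ bot_ne_top).ge ?_
      rintro _ ⟨x, rfl⟩
      change f * x * f ∈ _
      obtain ⟨c, hc, hcx⟩ := hcen (Φ x 0 0)
      have hdvd : (p : B) ∣ f * x * f - c * f := by
        rw [← hΦ0, map_sub, map_mul, map_mul, map_mul, hcx, hΦf, Matrix.single_mul_mul_single,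
          hscal]
        simp
      obtain ⟨y, hy⟩ := hdvd
      have hcf : f * c = c * f := Subring.mem_center_iff.mp hc f
      have hy' : f * (f * x * f - c * f) * f = f * x * f - c * f := by
        simp only [mul_sub, sub_mul]
        rw [← mul_assoc f c f, hcf]
        simp only [mul_assoc, hff']
        simp only [← mul_assoc, hff']
      have : f * x * f = c * f + (p : ℤ_[p]) • (f * y * f) := by
        rw [← sub_eq_iff_eq_add', ← hy', hy]
        have := PadicInt.pow_smul_eq_pow_mul (p := p) 1 (f * y * f)
        rw [pow_one, pow_one] at this
        rw [this, ← mul_assoc, ← (Nat.cast_commute p f).eq, mul_assoc, mul_assoc, mul_assoc]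
      rw [this]
      refine Submodule.add_mem_sup ⟨c, hc, rfl⟩ (Submodule.smul_mem_smul ?_ ⟨y, rfl⟩)
      rw [PadicInt.maximalIdeal_eq_span_p]
      exact Ideal.mem_span_singleton_self _
    intro x
    obtain ⟨r, hr, hrx⟩ := hN ⟨x, rfl⟩
    exact ⟨r, hr, hrx.symm⟩
  choose u₀ hu₀ using fun a : Fin d => hΦ (Matrix.single a 0 1)
  choose v₀ hv₀ using fun a : Fin d => hΦ (Matrix.single 0 a 1)
  choose c hc hcuv using fun a b => hcorner (v₀ a * u₀ b)
  -- Arbitrary lifts pair to a Gram matrix over the centre which is the identity modulo `p`, hence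
  -- invertible; its inverse corrects the `v₀` to a dual family.
  let C : Matrix (Fin d) (Fin d) (Subalgebra.center ℤ_[p] B) := Matrix.of fun a b => ⟨c a b, hc a b⟩
  have hdet : IsUnit C.det := by
    refine isUnit_det_of_natCast_dvd_sub_one (p := p) fun a b => ?_
    have hmem1 : c a b - (1 : Matrix (Fin d) (Fin d) B) a b ∈ Subring.center B := by
      refine sub_mem (hc a b) ?_
      rw [Matrix.one_apply]
      split_ifs
      · exact one_mem _
      · exact zero_mem _
    obtain ⟨y, hy, hy'⟩ := hdiv _ hmem1 (by
      obtain ⟨t, ht⟩ : ∃ t, Φ (c a b) = Matrix.scalar (Fin d) t := by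
        have h1 : Φ (c a b) ∈ Set.center (Matrix (Fin d) (Fin d) D) := by
          rw [Semigroup.mem_center_iff]
          intro g
          obtain ⟨g, rfl⟩ := hΦ g
          rw [← map_mul, ← map_mul, Subring.mem_center_iff.mp (hc a b)]
        rw [Matrix.center_eq_scalar_image] at h1
        obtain ⟨t, -, ht⟩ := h1
        exact ⟨t, ht.symm⟩
      have h2 := congrArg Φ (hcuv a b)
      rw [map_mul, map_mul, map_mul, map_mul, hΦf, hv₀, hu₀, ht, hscal] at h2
      have h3 := congrFun (congrFun h2 0) 0
      rw [← hΦ0, map_sub, ht]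
      by_cases hab : a = b
      · subst hab
        simp at h3
        simp [← h3]
      · simp [hab] at h3
        simp [← h3, hab])
    refine ⟨⟨y, hy⟩, Subtype.ext (Eq.trans ?_ hy')⟩
    by_cases hab : a = b
    · subst hab; simp [C]; rfl
    · simp [C, hab]; exact sub_zero _
  let M := C⁻¹
  have hMC : M * C = 1 := Matrix.nonsing_inv_mul C hdet
  have hMc : ∀ a b x, x * (M a b : B) = M a b * x := fun a b x =>
    Subring.mem_center_iff.mp (M a b).2 x
  let u : Fin d → B := fun a => u₀ a * f
  let v : Fin d → B := fun a => ∑ b, (M a b : B) * (f * v₀ b)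
  have huf : ∀ a, u a * f = u a := fun a => by simp only [u, mul_assoc, hff']
  have hvu : ∀ a b, v a * u b = if a = b then f else 0 := by
    intro a b
    have h1 : v a * u b = ((M * C) a b : Subalgebra.center ℤ_[p] B) * f := by
      simp only [v, Finset.sum_mul, Matrix.mul_apply, AddSubmonoidClass.coe_finsetSum]
      refine Finset.sum_congr rfl fun b' _ => ?_
      rw [MulMemClass.coe_mul, mul_assoc, mul_assoc (M a b' : B)]
      congr 1
      simp only [u, C, Matrix.of_apply]
      rw [← hcuv]
      simp only [mul_assoc]
    rw [h1, hMC]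
    by_cases hab : a = b
    · subst hab; simp
    · simp [hab]
  have hΦu : ∀ a, Φ (u a) = Matrix.single a 0 1 := fun a => by
    simp only [u, map_mul, hu₀, hΦf, Matrix.single_mul_single_same, mul_one]
  have hΦv : ∀ a, Φ (v a) = Matrix.single 0 a 1 := fun a => by
    calc Φ (v a) = ∑ b, Φ (v a * u b) * Matrix.single 0 b 1 := by
          simp_rw [map_mul, mul_assoc, hΦu, Matrix.single_mul_single_same, mul_one,
            ← Finset.mul_sum, Matrix.sum_single_one, mul_one]
      _ = _ := by
        rw [Finset.sum_eq_single a _ (by simp)]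
        · rw [hvu, if_pos rfl, hΦf, Matrix.single_mul_single_same, mul_one]
        · intro b _ hb
          rw [hvu, if_neg hb.symm, map_zero, zero_mul]
  refine ⟨f, u, v, huf, hvu, ?_, hcorner⟩
  -- The complement of this idempotent is divisible by `p`, hence zero.
  have hs : IsIdempotentElem (∑ a, u a * v a) := by
    rw [IsIdempotentElem, Finset.sum_mul]
    refine Finset.sum_congr rfl fun a _ => ?_
    rw [Finset.mul_sum, Finset.sum_eq_single a _ (by simp)]
    · rw [mul_assoc, ← mul_assoc (v a), hvu, if_pos rfl, ← mul_assoc, huf]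
    · intro b _ hb
      rw [mul_assoc, ← mul_assoc (v a), hvu, if_neg hb.symm, zero_mul, mul_zero]
  have := hs.one_sub.eq_zero_of_natCast_dvd (p := p) (by
    rw [← hΦ0]
    simp_rw [map_sub, map_sum, map_mul, hΦu, hΦv, Matrix.single_mul_single_same, mul_one,
      Matrix.sum_single_one, map_one, sub_self])
  exact (sub_eq_zero.mp this).symm

/-- A central element reduces to a scalar in the finite field `D`, where Frobenius is surjective;
the `p`th root lifts to the centre. -/
theorem exists_eq_pow_add_of_surjective_matrix {p : ℕ} [Fact p.Prime] {B : Type*} [Ring B]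
    {D : Type*} [Field D] [Finite D] {d : ℕ} [NeZero d]
    (Φ : B →+* Matrix (Fin d) (Fin d) D) (hΦ : Function.Surjective Φ)
    (hΦ0 : ∀ x, Φ x = 0 ↔ (p : B) ∣ x)
    (hcen : ∀ s : D, ∃ c ∈ Subring.center B, Φ c = Matrix.scalar (Fin d) s)
    {z : B} (hz : z ∈ Subring.center B) :
    ∃ y ∈ Subring.center B, (p : B) ∣ z - y ^ p := by
  have hD : CharP D p := by
    refine ringChar.of_eq (CharP.ringChar_of_prime_eq_zero Fact.out ?_)
    have h0 := congrFun (congrFun ((hΦ0 (p : B)).mpr dvd_rfl) 0) 0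
    rw [map_natCast, ← map_natCast (Matrix.scalar (Fin d))] at h0
    rwa [Matrix.scalar_apply, Matrix.diagonal_apply_eq] at h0
  obtain ⟨t, ht⟩ : ∃ t, Φ z = Matrix.scalar (Fin d) t := by
    have h1 : Φ z ∈ Set.center (Matrix (Fin d) (Fin d) D) := by
      rw [Semigroup.mem_center_iff]
      intro g
      obtain ⟨g, rfl⟩ := hΦ g
      rw [← map_mul, ← map_mul, Subring.mem_center_iff.mp hz]
    rw [Matrix.center_eq_scalar_image] at h1
    obtain ⟨t, -, ht⟩ := h1
    exact ⟨t, ht.symm⟩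
  obtain ⟨s, rfl⟩ := (Finite.injective_iff_surjective.mp (frobenius_inj D p)) t
  obtain ⟨y, hy, hys⟩ := hcen s
  refine ⟨y, hy, ?_⟩
  rw [← hΦ0, map_sub, map_pow, ht, hys, frobenius_def, map_pow, sub_self]

/-- From `z = y^p + p x` one gets `dz = p y^(p-1) dy + p dx`, so `Ω = pΩ` and Nakayama kills `Ω`. -/
theorem unramified_of_forall_exists_eq_pow_add {C : Type*} [CommRing C] [Algebra ℤ_[p] C]
    [Module.Finite ℤ_[p] C] (h : ∀ z : C, ∃ y x : C, z = y ^ p + p * x) :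
    Algebra.Unramified ℤ_[p] C := by
  have : Algebra.FormallyUnramified ℤ_[p] C := by
    refine ⟨?_⟩
    have hfin : Module.Finite ℤ_[p] (Ω[C⁄ℤ_[p]]) := Module.Finite.trans C _
    have hle : (⊤ : Submodule ℤ_[p] (Ω[C⁄ℤ_[p]])) ≤
        IsLocalRing.maximalIdeal ℤ_[p] • (⊤ : Submodule ℤ_[p] (Ω[C⁄ℤ_[p]])) := by
      have hpm : ∀ ω : Ω[C⁄ℤ_[p]], (p : ℕ) • ω ∈
          IsLocalRing.maximalIdeal ℤ_[p] • (⊤ : Submodule ℤ_[p] (Ω[C⁄ℤ_[p]])) := fun ω => by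
        rw [← Nat.cast_smul_eq_nsmul ℤ_[p]]
        refine Submodule.smul_mem_smul ?_ trivial
        rw [PadicInt.maximalIdeal_eq_span_p]
        exact Ideal.mem_span_singleton_self _
      intro ω _
      have hω : ω ∈ Submodule.span C (Set.range (KaehlerDifferential.D ℤ_[p] C)) := by
        rw [KaehlerDifferential.span_range_derivation]
        trivial
      induction hω using Submodule.span_induction with
      | mem ω hω =>
        obtain ⟨z, rfl⟩ := hω
        obtain ⟨y, x, rfl⟩ := h z
        rw [map_add, Derivation.leibniz_pow, Derivation.leibniz]
        refine add_mem (hpm _) (add_mem ?_ ?_)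
        · rw [Nat.cast_smul_eq_nsmul]
          exact hpm _
        · rw [Derivation.map_natCast, smul_zero]
          exact zero_mem _
      | zero => exact zero_mem _
      | add a b _ _ ha hb => exact add_mem (ha trivial) (hb trivial)
      | smul c a _ ha =>
        refine Submodule.smul_induction_on (ha trivial) ?_ ?_
        · intro r hr n _
          rw [smul_comm]
          exact Submodule.smul_mem_smul hr trivial
        · intro a b ha hb
          rw [smul_add]
          exact add_mem ha hb
    have := Submodule.eq_bot_of_le_smul_of_le_jacobson_bot _ _ Module.Finite.fg_top hle
      (IsLocalRing.jacobson_eq_maximalIdeal _ bot_ne_top).ge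
    exact (Submodule.subsingleton_iff ℤ_[p]).mp (subsingleton_of_bot_eq_top this.symm)
  exact { }

end Lifting

/-! ### Integrality from traces on lattices; maximal orders. -/

section Trace

variable {p : ℕ} [Fact p.Prime]

theorem Submodule.IsLattice.exists_trace_eq_algebraMap {R K V : Type*} [CommRing R] [IsDomain R]
    [IsPrincipalIdealRing R] [Field K] [Algebra R K] [IsFractionRing R K] [AddCommGroup V]
    [Module R V] [Module K V] [IsScalarTower R K V] (M : Submodule R V)
    [Submodule.IsLattice K M] (f : V →ₗ[K] V) (hf : ∀ x ∈ M, f x ∈ M) :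
    ∃ a : R, LinearMap.trace K V f = algebraMap R K a := by
  classical
  have : Module.IsTorsionFree R K := inferInstance
  have := Submodule.IsLattice.free (K := K) M
  let b := Module.Free.chooseBasis R M
  let b' := b.extendOfIsLattice K
  have : ∀ i, b'.repr (f (b' i)) i = algebraMap R K (b.repr ⟨f (b i), hf _ (b i).2⟩ i) := by
    intro i
    have h1 : f (b' i) = ∑ j, algebraMap R K (b.repr ⟨f (b i), hf _ (b i).2⟩ j) • b' j := by
      have h2 := congrArg Subtype.val (b.sum_repr ⟨f (b i), hf _ (b i).2⟩)
      simp only [AddSubmonoidClass.coe_finsetSum, Submodule.coe_smul] at h2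
      simp only [b', Module.Basis.extendOfIsLattice_apply, algebraMap_smul]
      exact h2.symm
    rw [h1]
    simp only [map_sum, map_smul, Module.Basis.repr_self, Finsupp.coe_finsetSum, Finset.sum_apply,
      Finsupp.smul_single, smul_eq_mul, mul_one]
    rw [Finset.sum_eq_single i (fun j _ hj => Finsupp.single_eq_of_ne hj.symm) (by simp),
      Finsupp.single_eq_same]
  refine ⟨∑ i, b.repr ⟨f (b i), hf _ (b i).2⟩ i, ?_⟩
  rw [LinearMap.trace_eq_matrix_trace K b', Matrix.trace, map_sum]
  refine Finset.sum_congr rfl fun i _ => ?_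
  rw [Matrix.diag_apply, LinearMap.toMatrix_apply, this]

/-- The diagonal entry at `g` is the coefficient of `g` in `x g w`, that is, of `1` in `x g w g⁻¹`.
-/
theorem MonoidAlgebra.trace_mulLeft_comp_mulRight {k G : Type*} [Field k] [Group G] [Fintype G]
    (x w : MonoidAlgebra k G) :
    LinearMap.trace k _ (LinearMap.mulLeft k x ∘ₗ LinearMap.mulRight k w) =
      (x * ∑ g, MonoidAlgebra.of k G g * w * MonoidAlgebra.of k G g⁻¹).coeff 1 := by
  classical
  rw [LinearMap.trace_eq_matrix_trace k (MonoidAlgebra.basis G k), Matrix.trace, Finset.mul_sum]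
  have : ∀ s : G → MonoidAlgebra k G, (∑ g, s g).coeff 1 = ∑ g, (s g).coeff 1 := fun s => by
    simp
  rw [this]
  refine Finset.sum_congr rfl fun g _ => ?_
  rw [Matrix.diag_apply, LinearMap.toMatrix_apply, MonoidAlgebra.basis_apply]
  simp only [LinearMap.comp_apply, LinearMap.mulRight_apply, LinearMap.mulLeft_apply,
    MonoidAlgebra.of_apply, ← mul_assoc, MonoidAlgebra.coeff_mul_single_apply]
  simp [MonoidAlgebra.basis]

variable {G : Type u} [Group G]

theorem mem_integralGroupRing_iff {x : MonoidAlgebra ℚ_[p] G} :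
    x ∈ integralGroupRing p G ↔ ∀ g, ∃ a : ℤ_[p], x.coeff g = algebraMap ℤ_[p] ℚ_[p] a := by
  constructor
  · rintro ⟨y, rfl⟩ g
    exact ⟨y.coeff g, by simp⟩
  · intro h
    choose a ha using h
    refine ⟨.ofCoeff (Finsupp.onFinset x.coeff.support a fun g hg => ?_), ?_⟩
    · rw [Finsupp.mem_support_iff, ha]
      exact (map_ne_zero_iff _ (IsFractionRing.injective ℤ_[p] ℚ_[p])).mpr hg
    · ext g
      simp [ha]

theorem of_mem_integralGroupRing (g : G) :
    MonoidAlgebra.of ℚ_[p] G g ∈ integralGroupRing p G :=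
  ⟨MonoidAlgebra.of ℤ_[p] G g, by simp⟩

theorem isPadicOrder_integralGroupRing [Finite G] : IsPadicOrder p (integralGroupRing p G) where
  finite := by
    have : Module.Finite ℤ_[p] (MonoidAlgebra ℤ_[p] G) :=
      Module.Finite.of_basis (MonoidAlgebra.basis G ℤ_[p])
    exact Module.Finite.of_surjective
      (MonoidAlgebra.mapAlgHom G (Algebra.ofId ℤ_[p] ℚ_[p])).rangeRestrict.toLinearMap
      (AlgHom.rangeRestrict_surjective _)
  span_eq_top := by
    rw [eq_top_iff, ← (MonoidAlgebra.basis G ℚ_[p]).span_eq]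
    refine Submodule.span_mono ?_
    rintro _ ⟨g, rfl⟩
    rw [MonoidAlgebra.basis_apply]
    exact of_mem_integralGroupRing g

theorem IsPadicOrder.isLattice {A : Type u} [Ring A] [Algebra ℤ_[p] A] [Algebra ℚ_[p] A]
    [IsScalarTower ℤ_[p] ℚ_[p] A] {Γ : Subalgebra ℤ_[p] A} (h : IsPadicOrder p Γ) :
    Submodule.IsLattice ℚ_[p] (Subalgebra.toSubmodule Γ) where
  fg := Module.Finite.iff_fg.mp h.finite
  span_eq_top := h.span_eq_top

/-- The coefficient at `g` is the trace of `y ↦ g⁻¹ x y w`, which preserves the lattice `M` and so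
has integral trace. -/
theorem mul_sum_conj_mem_integralGroupRing [Fintype G] (M : Submodule ℤ_[p] (MonoidAlgebra ℚ_[p] G))
    [Submodule.IsLattice ℚ_[p] M] (x w : MonoidAlgebra ℚ_[p] G)
    (h : ∀ g, ∀ m ∈ M, MonoidAlgebra.of ℚ_[p] G g * x * (m * w) ∈ M) :
    x * ∑ g, MonoidAlgebra.of ℚ_[p] G g * w * MonoidAlgebra.of ℚ_[p] G g⁻¹ ∈
      integralGroupRing p G := by
  rw [mem_integralGroupRing_iff]
  intro g
  obtain ⟨a, ha⟩ := Submodule.IsLattice.exists_trace_eq_algebraMap M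
    (LinearMap.mulLeft ℚ_[p] (MonoidAlgebra.of ℚ_[p] G g⁻¹ * x) ∘ₗ LinearMap.mulRight ℚ_[p] w)
    (h g⁻¹)
  rw [MonoidAlgebra.trace_mulLeft_comp_mulRight, mul_assoc, MonoidAlgebra.of_apply,
    MonoidAlgebra.coeff_single_mul_apply] at ha
  exact ⟨a, by simpa using ha⟩

theorem IsPadicOrder.mul_sum_conj_mem [Fintype G]
    {M : Subalgebra ℤ_[p] (MonoidAlgebra ℚ_[p] G)} (hM : IsPadicOrder p M)
    (hLM : integralGroupRing p G ≤ M) {x w : MonoidAlgebra ℚ_[p] G} (hx : x ∈ M) (hw : w ∈ M) :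
    x * ∑ g, MonoidAlgebra.of ℚ_[p] G g * w * MonoidAlgebra.of ℚ_[p] G g⁻¹ ∈
      integralGroupRing p G := by
  have := hM.isLattice
  exact mul_sum_conj_mem_integralGroupRing (Subalgebra.toSubmodule M) x w fun g m hm =>
    M.mul_mem (M.mul_mem (hLM (of_mem_integralGroupRing g)) hx) (M.mul_mem hm hw)

theorem IsIntegral.mul_sum_conj_mem [Fintype G] {x w : MonoidAlgebra ℚ_[p] G}
    (hx : IsIntegral ℤ_[p] x) (hxc : x ∈ Subring.center (MonoidAlgebra ℚ_[p] G))
    (hw : w ∈ integralGroupRing p G) :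
    x * ∑ g, MonoidAlgebra.of ℚ_[p] G g * w * MonoidAlgebra.of ℚ_[p] G g⁻¹ ∈
      integralGroupRing p G := by
  set L := integralGroupRing p G
  have hL := (isPadicOrder_integralGroupRing (p := p) (G := G)).isLattice
  have hcomm : ∀ {c}, c ∈ Algebra.adjoin ℤ_[p] {x} → ∀ y, y * c = c * y := by
    intro c hc y
    have : Algebra.adjoin ℤ_[p] {x} ≤ Subalgebra.center ℤ_[p] _ :=
      Algebra.adjoin_le (Set.singleton_subset_iff.mpr hxc)
    exact Subalgebra.mem_center_iff.mp (this hc) y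
  -- The invariant lattice is `ℤ_p[G] · ℤ_p[x]`, finitely generated because `x` is integral.
  have : Submodule.IsLattice ℚ_[p]
      (Subalgebra.toSubmodule L * Subalgebra.toSubmodule (Algebra.adjoin ℤ_[p] {x})) :=
    Submodule.IsLattice.of_le_of_isLattice_of_fg ℚ_[p] (M := Subalgebra.toSubmodule L)
      (fun y hy => by
        have := Submodule.mul_mem_mul hy (show (1 : MonoidAlgebra ℚ_[p] G) ∈
          Subalgebra.toSubmodule (Algebra.adjoin ℤ_[p] {x}) from
            (Algebra.adjoin ℤ_[p] {x}).one_mem)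
        rwa [mul_one] at this)
      (hL.fg.mul hx.fg_adjoin_singleton)
  refine mul_sum_conj_mem_integralGroupRing
    (Subalgebra.toSubmodule L * Subalgebra.toSubmodule (Algebra.adjoin ℤ_[p] {x})) x w ?_
  intro g m hm
  induction hm using Submodule.mul_induction_on' with
  | mem_mul_mem l hl c hc =>
    have hc' : x * c ∈ Algebra.adjoin ℤ_[p] {x} :=
      mul_mem (Algebra.subset_adjoin rfl) hc
    have : MonoidAlgebra.of ℚ_[p] G g * x * (l * c * w) =
        MonoidAlgebra.of ℚ_[p] G g * (l * w) * (x * c) := by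
      rw [mul_assoc l c w, ← hcomm hc w, mul_assoc _ x, mul_assoc _ (l * w), ← mul_assoc l w c,
        ← mul_assoc x, ← Subring.mem_center_iff.mp hxc (l * w), mul_assoc (l * w)]
    rw [this]
    exact Submodule.mul_mem_mul (L.mul_mem (of_mem_integralGroupRing g) (L.mul_mem hl hw)) hc'
  | add a _ b _ ha hb =>
    rw [add_mul, mul_add]
    exact add_mem ha hb

theorem exists_isMaximalPadicOrder_ge [Finite G] :
    ∃ M : Subalgebra ℤ_[p] (MonoidAlgebra ℚ_[p] G),
      IsMaximalPadicOrder p M ∧ integralGroupRing p G ≤ M := by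
  have := Fintype.ofFinite G
  set L := integralGroupRing p G
  have hLo : IsPadicOrder p L := isPadicOrder_integralGroupRing
  let m : MonoidAlgebra ℚ_[p] G →ₗ[ℤ_[p]] MonoidAlgebra ℚ_[p] G :=
    LinearMap.lsmul ℤ_[p] _ (Fintype.card G : ℤ_[p])
  have hm : ∀ x, m x = (Fintype.card G : ℚ_[p]) • x := fun x => by
    simp [m, Nat.cast_smul_eq_nsmul]
  have hminj : Function.Injective m := by
    intro x y hxy
    rw [hm, hm] at hxy
    exact smul_right_injective _ (by simp) hxy
  let K : Submodule ℤ_[p] (MonoidAlgebra ℚ_[p] G) := (Subalgebra.toSubmodule L).comap m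
  -- Taking `w = 1`, whose trace is `|G|`, gives `|G| M ⊆ L`. All orders above `L` thus lie in one
  -- Noetherian module, which supplies a maximal one.
  have hK : ∀ M : Subalgebra ℤ_[p] (MonoidAlgebra ℚ_[p] G), IsPadicOrder p M → L ≤ M →
      Subalgebra.toSubmodule M ≤ K := by
    intro M hM hLM x hx
    have := hM.mul_sum_conj_mem hLM hx (one_mem M)
    change m x ∈ L
    simp only [mul_one, ← map_mul, mul_inv_cancel, map_one, Finset.sum_const, Finset.card_univ]
      at this
    rw [hm]
    simpa [← Nat.cast_smul_eq_nsmul ℚ_[p]] using this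
  have hKn : IsNoetherian ℤ_[p] K := by
    have := hLo.finite
    have : Module.Finite ℤ_[p] (Subalgebra.toSubmodule L) := this
    exact isNoetherian_of_injective (m.restrict (p := K) (q := Subalgebra.toSubmodule L)
      fun x hx => hx) fun x y hxy => Subtype.ext (hminj (congrArg Subtype.val hxy))
  let S : Set (Submodule ℤ_[p] K) := {Q | ∃ M : Subalgebra ℤ_[p] (MonoidAlgebra ℚ_[p] G),
    IsPadicOrder p M ∧ L ≤ M ∧ Q = (Subalgebra.toSubmodule M).comap K.subtype}
  obtain ⟨_, ⟨M, hM, hLM, rfl⟩, hmax⟩ := set_has_maximal_iff_noetherian.mpr hKn S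
    ⟨_, L, hLo, le_rfl, rfl⟩
  refine ⟨M, ⟨hM, fun M' hM' hMM' => ?_⟩, hLM⟩
  have hnot := hmax _ ⟨M', hM', hLM.trans hMM', rfl⟩
  intro x hx
  by_contra hxM
  refine hnot (lt_of_le_not_ge (fun y hy => hMM' hy) fun hle => hxM ?_)
  exact hle (x := ⟨x, hK M' hM' (hLM.trans hMM') hx⟩) hx

end Trace

/-! ### The trace idempotent and the hybrid property. -/

section TraceIdempotent

variable {p : ℕ} [Fact p.Prime] {G : Type u} [Group G]

theorem of_mul_traceIdempotent [Finite G] (N : Subgroup G) {n : G} (hn : n ∈ N) :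
    MonoidAlgebra.of ℚ_[p] G n * traceIdempotent p N = traceIdempotent p N := by
  have := Fintype.ofFinite N
  rw [traceIdempotent, finsum_eq_sum_of_fintype, mul_smul_comm, Finset.mul_sum]
  congr 1
  refine Fintype.sum_equiv (Equiv.mulLeft ⟨n, hn⟩) _ _ fun σ => ?_
  simp

theorem isIdempotentElem_traceIdempotent [Finite G] (N : Subgroup G) :
    IsIdempotentElem (traceIdempotent p N) := by
  have := Fintype.ofFinite N
  rw [IsIdempotentElem]
  nth_rw 1 [traceIdempotent]
  rw [finsum_eq_sum_of_fintype, smul_mul_assoc, Finset.sum_mul,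
    Finset.sum_congr rfl fun σ _ => of_mul_traceIdempotent N σ.2, Finset.sum_const,
    Finset.card_univ, ← Nat.cast_smul_eq_nsmul ℚ_[p], smul_smul, Nat.card_eq_fintype_card,
    inv_mul_cancel₀ (by simp), one_smul]

theorem IsFrobeniusKernel.exists_integral_sum_conj_eq [Fintype G] {N : Subgroup G}
    (hN : IsFrobeniusKernel N) (hp : ¬ p ∣ Nat.card N) :
    ∃ e w : MonoidAlgebra ℤ_[p] G,
      ∑ g, MonoidAlgebra.of ℤ_[p] G g * w * MonoidAlgebra.of ℤ_[p] G g⁻¹ = 1 - e ∧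
      MonoidAlgebra.mapAlgHom G (Algebra.ofId ℤ_[p] ℚ_[p]) e = traceIdempotent p N ∧
      ∃ c : ℤ_[p], c * Nat.card N = 1 ∧ e = c • ∑ᶠ σ : N, MonoidAlgebra.of ℤ_[p] G (σ : G) := by
  classical
  have hu : IsUnit (Nat.card N : ℤ_[p]) := by
    rw [PadicInt.isUnit_iff, PadicInt.norm_natCast_eq_one_iff]
    exact (Nat.Prime.coprime_iff_not_dvd Fact.out).mpr hp
  obtain ⟨c, hc⟩ := hu.exists_left_inv
  obtain ⟨w, hw⟩ := hN.exists_sum_conj_eq c hc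
  refine ⟨_, w, hw, ?_, c, hc, rfl⟩
  have hc' : algebraMap ℤ_[p] ℚ_[p] c = (Nat.card N : ℚ_[p])⁻¹ := by
    refine eq_inv_of_mul_eq_one_left ?_
    rw [← map_natCast (algebraMap ℤ_[p] ℚ_[p]), ← map_mul, hc, map_one]
  rw [traceIdempotent, finsum_eq_sum_of_fintype, finsum_eq_sum_of_fintype, map_smul, map_sum,
    ← hc', algebraMap_smul]
  simp

/-- Any maximal order `M` above `ℤ_p[G]` works: as `1 - e_N` is the trace of an integral `w`, the
trace argument gives `M (1 - e_N) ⊆ ℤ_p[G]`. -/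
theorem IsFrobeniusKernel.isHybrid [Finite G] {N : Subgroup G}
    (hN : IsFrobeniusKernel N) (hp : ¬ p ∣ Nat.card N) : IsHybrid p N := by
  have := Fintype.ofFinite G
  obtain ⟨e, w, hw, he, -⟩ := hN.exists_integral_sum_conj_eq hp
  set L := integralGroupRing p G
  have heL : traceIdempotent p N ∈ L := ⟨e, he⟩
  have hidem := isIdempotentElem_traceIdempotent (p := p) N
  have hw' := congrArg (MonoidAlgebra.mapAlgHom G (Algebra.ofId ℤ_[p] ℚ_[p])) hw
  rw [map_sub, map_one, he, map_sum] at hw'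
  simp only [map_mul, MonoidAlgebra.of_apply, MonoidAlgebra.mapAlgHom_single, map_one] at hw'
  obtain ⟨M, hM, hLM⟩ := exists_isMaximalPadicOrder_ge (p := p) (G := G)
  refine ⟨M, hM, hLM, ?_, ?_⟩
  · rw [Submodule.disjoint_def]
    rintro _ ⟨x, -, rfl⟩ ⟨y, -, hy⟩
    have hy' : y * (1 - traceIdempotent p N) = x * traceIdempotent p N := hy
    change x * traceIdempotent p N = 0
    calc x * traceIdempotent p N = x * traceIdempotent p N * traceIdempotent p N := by
          rw [mul_assoc, hidem.eq]
      _ = 0 := by rw [← hy', mul_assoc, hidem.one_sub_mul_self, mul_zero]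
  · apply le_antisymm
    · intro x hx
      have : x = x * traceIdempotent p N + x * (1 - traceIdempotent p N) := by
        rw [← mul_add]; simp
      rw [this]
      exact Submodule.add_mem_sup ⟨x, hx, rfl⟩ ⟨x, hLM hx, rfl⟩
    · refine sup_le ?_ ?_
      · rintro _ ⟨x, hx, rfl⟩
        exact L.mul_mem hx heL
      · rintro _ ⟨x, hx, rfl⟩
        have := hM.prop.mul_sum_conj_mem hLM hx (hLM ⟨w, rfl⟩)
        change x * (1 - traceIdempotent p N) ∈ L
        rw [← hw']
        exact this

end TraceIdempotent

/-! ### Structure of a component order. -/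

section OrderStructure

variable {p : ℕ} [Fact p.Prime]

/-- An indecomposable order over `ℤ_p` that is a quotient of a group ring in which `1` is a trace
is a full matrix ring over an unramified extension of `ℤ_p`. -/
theorem unramified_and_nonempty_matrix_algEquiv {A F : Type u} [Ring A] [Nontrivial A]
    [Algebra ℚ_[p] A] [Algebra ℤ_[p] A] [IsScalarTower ℤ_[p] ℚ_[p] A] [CommRing F]
    [Algebra ℚ_[p] F] [Algebra ℤ_[p] F] [IsScalarTower ℤ_[p] ℚ_[p] F]
    {G : Type*} [Group G] [Fintype G] (θ : MonoidAlgebra ℤ_[p] G →ₐ[ℤ_[p]] A)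
    (hspan : ∀ x : A, ∃ b : ℤ_[p], b ≠ 0 ∧ b • x ∈ θ.range) (w : MonoidAlgebra ℤ_[p] G)
    (hw : θ (∑ g, MonoidAlgebra.of ℤ_[p] G g * w * MonoidAlgebra.of ℤ_[p] G g⁻¹) = 1)
    (hconn : ∀ z ∈ Subring.center A, IsIdempotentElem z → z = 0 ∨ z = 1)
    (hint : ∀ x ∈ Subring.center A, IsIntegral ℤ_[p] x → x ∈ θ.range)
    (j : F →ₐ[ℚ_[p]] A) (hj : Function.Injective j)
    (hjr : ∀ x, x ∈ j.range ↔ x ∈ Subring.center A) :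
    Algebra.Unramified ℤ_[p] (integralClosure ℤ_[p] F) ∧
    ∃ m : ℕ, Nonempty (A ≃ₐ[ℚ_[p]] Matrix (Fin m) (Fin m) F) ∧
      Nonempty (θ.range ≃ₐ[ℤ_[p]] Matrix (Fin m) (Fin m) (integralClosure ℤ_[p] F)) := by
  have hGfin : Module.Finite ℤ_[p] (MonoidAlgebra ℤ_[p] G) :=
    Module.Finite.of_basis (MonoidAlgebra.basis G ℤ_[p])
  have hBfin : Module.Finite ℤ_[p] θ.range :=
    Module.Finite.of_surjective θ.rangeRestrict.toLinearMap θ.rangeRestrict_surjective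
  let u : G →* θ.range := θ.rangeRestrict.toRingHom.toMonoidHom.comp (MonoidAlgebra.of ℤ_[p] G)
  have hu : Submodule.span ℤ_[p] (Set.range u) = ⊤ := by
    have h1 : Set.range u = θ.rangeRestrict.toLinearMap ''
        Set.range (MonoidAlgebra.basis G ℤ_[p]) := by
      rw [← Set.range_comp]
      congr 1
    rw [h1, ← Submodule.map_span, Module.Basis.span_eq, Submodule.map_top,
      LinearMap.range_eq_top]
    exact θ.rangeRestrict_surjective
  have hw' : ∑ g, u g * θ.rangeRestrict w * u g⁻¹ = 1 := by
    refine Subtype.ext ?_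
    rw [map_sum] at hw
    simpa [u] using hw
  have hcenA : ∀ z : θ.range, z ∈ Subring.center θ.range ↔ (z : A) ∈ Subring.center A := by
    intro z
    rw [Subring.mem_center_iff, Subring.mem_center_iff]
    constructor
    · intro h x
      obtain ⟨b, hb, y, hy⟩ := hspan x
      have h1 := congrArg Subtype.val (h ⟨θ y, y, rfl⟩)
      have h2 : b • (x * z) = b • (z * x) := by
        rw [← smul_mul_assoc, ← mul_smul_comm, ← hy]
        exact h1
      rw [← algebraMap_smul ℚ_[p] b, ← algebraMap_smul ℚ_[p] b] at h2
      exact smul_right_injective _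
        ((map_ne_zero_iff _ (IsFractionRing.injective ℤ_[p] ℚ_[p])).mpr hb) h2
    · intro h x
      exact Subtype.ext (h x)
  have hconn' : ∀ z ∈ Subring.center θ.range, IsIdempotentElem z → z = 0 ∨ z = 1 := by
    intro z hz hzi
    obtain h | h := hconn z ((hcenA z).mp hz) (congrArg Subtype.val hzi)
    · exact Or.inl (Subtype.ext h)
    · exact Or.inr (Subtype.ext h)
  obtain ⟨D, _, _, d, _, Φ, hΦ, hΦ0, hcen⟩ :=
    exists_surjective_matrix_finite_field u hu _ hw' hconn'
  have hdiv : ∀ z ∈ Subring.center θ.range, (p : θ.range) ∣ z →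
      ∃ y ∈ Subring.center θ.range, z = p * y := fun z hz h =>
    exists_mem_center_eq_natCast_mul u hu hw' hz h
  have hjZ : ∀ (r : ℤ_[p]), j (algebraMap ℤ_[p] F r) = algebraMap ℤ_[p] A r := fun r => by
    rw [IsScalarTower.algebraMap_apply ℤ_[p] ℚ_[p] F, j.commutes,
      ← IsScalarTower.algebraMap_apply]
  -- This identifies the integral closure with the centre of the order: `hint` puts integral central
  -- elements into the order, and conversely the order is finite over `ℤ_p`, so its elements are
  -- integral.
  let jR : integralClosure ℤ_[p] F →ₐ[ℤ_[p]] θ.range :=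
    AlgHom.codRestrict ((j.restrictScalars ℤ_[p]).comp (integralClosure ℤ_[p] F).val) θ.range
      fun x => hint _ ((hjr _).mp ⟨x, rfl⟩) (x.2.map (j.restrictScalars ℤ_[p]))
  have hjR : ∀ x, (jR x : A) = j x := fun x => rfl
  have hjRinj : Function.Injective jR := fun x y hxy =>
    Subtype.ext (hj (congrArg Subtype.val hxy))
  have hjRc : ∀ x, jR x ∈ Subring.center θ.range := fun x =>
    (hcenA _).mpr ((hjr _).mp ⟨x, rfl⟩)
  have hjRs : ∀ z ∈ Subring.center θ.range, ∃ x, jR x = z := by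
    intro z hz
    obtain ⟨x, hx⟩ := (hjr _).mpr ((hcenA z).mp hz)
    have hzint : IsIntegral ℤ_[p] (z : A) :=
      (Algebra.IsIntegral.isIntegral (R := ℤ_[p]) z).map θ.range.val
    have hx' : j x = z := hx
    have hxint : IsIntegral ℤ_[p] x := by
      rw [← isIntegral_algHom_iff (j.restrictScalars ℤ_[p]) hj]
      change IsIntegral ℤ_[p] (j x)
      rwa [hx']
    exact ⟨⟨x, hxint⟩, Subtype.ext hx'⟩
  have hRfin : Module.Finite ℤ_[p] (integralClosure ℤ_[p] F) :=
    Module.Finite.of_injective jR.toLinearMap hjRinj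
  refine ⟨unramified_of_forall_exists_eq_pow_add fun z => ?_, d, ?_⟩
  · obtain ⟨y, hy, hzy⟩ := exists_eq_pow_add_of_surjective_matrix Φ hΦ hΦ0 hcen (hjRc z)
    obtain ⟨x, hx, hzx⟩ := hdiv _ (sub_mem (hjRc z) (pow_mem hy p)) hzy
    obtain ⟨y, rfl⟩ := hjRs y hy
    obtain ⟨x, rfl⟩ := hjRs x hx
    refine ⟨y, x, hjRinj ?_⟩
    rw [map_add, map_pow, map_mul, map_natCast, ← hzx]
    abel
  obtain ⟨f, a, b, haf, hba, hab, hf⟩ := exists_matrix_units_lift Φ hΦ hΦ0 hcen hdiv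
  constructor
  · let _ : Algebra F A := j.toRingHom.toAlgebra' fun c x =>
      (Subring.mem_center_iff.mp ((hjr (j c)).mp ⟨c, rfl⟩) x).symm
    have hsmul : ∀ (c : F) (x : A), c • x = j c * x := fun c x => rfl
    have : IsScalarTower ℚ_[p] F A := IsScalarTower.of_algebraMap_eq fun r => (j.commutes r).symm
    obtain ⟨E⟩ := nonempty_matrix_algEquiv_of_units (R := F) (A := A) (fun r hr => by
        rw [hsmul, mul_one] at hr
        exact (map_eq_zero_iff j hj).mp hr) (f : A) (fun i => (a i : A)) (fun i => (b i : A))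
      (fun i => congrArg Subtype.val (haf i))
      (fun i k => by
        rw [← MulMemClass.coe_mul, hba]
        split_ifs <;> rfl)
      (by
        have := congrArg Subtype.val hab
        rw [AddSubmonoidClass.coe_finsetSum] at this
        exact this)
      (by
        intro x
        obtain ⟨b, hb, y, hy⟩ := hspan x
        obtain ⟨r, hr, hrf⟩ := hf ⟨θ y, y, rfl⟩
        obtain ⟨r, rfl⟩ := hjRs r hr
        have h1 : (f : A) * θ y * f = j r * f := congrArg Subtype.val hrf
        have hb' : algebraMap ℤ_[p] ℚ_[p] b ≠ 0 :=
          (map_ne_zero_iff _ (IsFractionRing.injective ℤ_[p] ℚ_[p])).mpr hb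
        -- The multiple `b • x` lies in the order, where the corner is known; dividing by `b` gives
        -- the scalar in `F`.
        refine ⟨(algebraMap ℤ_[p] ℚ_[p] b)⁻¹ • (r : F), ?_⟩
        rw [hsmul, map_smul, smul_mul_assoc, ← h1, eq_inv_smul_iff₀ hb', algebraMap_smul,
          ← smul_mul_assoc, ← mul_smul_comm]
        congr 2
        exact hy.symm)
    exact ⟨E.restrictScalars ℚ_[p]⟩
  · let _ : Algebra (integralClosure ℤ_[p] F) θ.range := jR.toRingHom.toAlgebra' fun c x =>
      (Subring.mem_center_iff.mp (hjRc c) x).symm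
    have hsmul : ∀ (c : integralClosure ℤ_[p] F) (x : θ.range), c • x = jR c * x :=
      fun c x => rfl
    have : IsScalarTower ℤ_[p] (integralClosure ℤ_[p] F) θ.range :=
      IsScalarTower.of_algebraMap_eq fun r => (jR.commutes r).symm
    obtain ⟨E⟩ := nonempty_matrix_algEquiv_of_units (R := integralClosure ℤ_[p] F)
      (A := θ.range) (fun r hr => by
        rw [hsmul, mul_one] at hr
        exact (map_eq_zero_iff jR hjRinj).mp hr) f a b haf hba hab (by
        intro x
        obtain ⟨r, hr, hrf⟩ := hf x
        obtain ⟨r, rfl⟩ := hjRs r hr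
        exact ⟨r, hrf⟩)
    exact ⟨E.restrictScalars ℤ_[p]⟩

end OrderStructure

/-! ### Primitive central idempotents. -/

section PrimitiveIdempotents

theorem IsPrimitiveCentralIdempotent.mul_eq_zero_of_ne {A : Type u} [Ring A] {e f : A}
    (he : IsPrimitiveCentralIdempotent e) (hf : IsPrimitiveCentralIdempotent f) (hef : e ≠ f) :
    e * f = 0 := by
  have hcomm : e * f = f * e := (Subring.mem_center_iff.mp he.central f).symm
  have hidem : IsIdempotentElem (e * f) := he.idem.mul_of_commute hcomm hf.idem
  have hcen : e * f ∈ Subring.center A := mul_mem he.central hf.central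
  obtain h | h := he.primitive _ hidem hcen (by
    rw [mul_assoc, ← hcomm, ← mul_assoc, he.idem.eq])
  · exact h
  obtain h' | h' := hf.primitive _ hidem hcen (by rw [mul_assoc, hf.idem.eq])
  · exact h'
  · exact absurd (h.symm.trans h') hef

/-- Induction on `dim δA`: a central idempotent properly below `δ` generates a strictly smaller
ideal. -/
theorem exists_isPrimitiveCentralIdempotent_mul_eq (k : Type*) {A : Type u} [Field k] [Ring A]
    [Algebra k A] [Module.Finite k A] {δ : A} (hδ : IsIdempotentElem δ)
    (hc : δ ∈ Subring.center A) (h0 : δ ≠ 0) :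
    ∃ e, IsPrimitiveCentralIdempotent e ∧ e * δ = e := by
  induction hn : Module.finrank k (LinearMap.range (LinearMap.mulLeft k δ)) using
    Nat.strong_induction_on generalizing δ with
  | _ n ih =>
    by_cases hprim : ∀ f : A, IsIdempotentElem f → f ∈ Subring.center A → f * δ = f →
      f = 0 ∨ f = δ
    · exact ⟨δ, ⟨hδ, hc, h0, hprim⟩, hδ⟩
    push Not at hprim
    obtain ⟨f, hf, hfc, hfδ, hf0, hfne⟩ := hprim
    have hδf : δ * f = f := by rw [← Subring.mem_center_iff.mp hc f, hfδ]
    have hlt : LinearMap.range (LinearMap.mulLeft k f) < LinearMap.range (LinearMap.mulLeft k δ) := by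
      refine lt_of_le_of_ne ?_ fun heq => ?_
      · rintro _ ⟨x, rfl⟩
        exact ⟨f * x, by simp [← mul_assoc, hδf]⟩
      · have h1 : δ ∈ LinearMap.range (LinearMap.mulLeft k δ) := ⟨1, by simp⟩
        rw [← heq] at h1
        obtain ⟨x, hx⟩ := h1
        have hx' : f * x = δ := hx
        apply hfne
        rw [← hfδ, ← hx', ← mul_assoc, hf.eq]
    obtain ⟨e, he, hef⟩ := ih _ (hn ▸ Submodule.finrank_lt_finrank_of_lt hlt) hf hfc hf0 rfl
    exact ⟨e, he, by rw [← hef, mul_assoc, hfδ]⟩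

theorem finite_isPrimitiveCentralIdempotent (k : Type*) {A : Type u} [Field k] [Ring A]
    [Algebra k A] [Module.Finite k A] : Finite {e : A // IsPrimitiveCentralIdempotent e} := by
  have : LinearIndependent k (fun e : {e : A // IsPrimitiveCentralIdempotent e} => (e : A)) := by
    rw [linearIndependent_iff']
    intro s g hg e he
    have h1 := congrArg ((e : A) * ·) hg
    simp only [mul_zero, Finset.mul_sum, mul_smul_comm] at h1
    rw [Finset.sum_eq_single e _ (fun h => absurd he h), e.2.idem.eq] at h1
    · exact (smul_eq_zero.mp h1).resolve_right e.2.ne_zero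
    · intro f _ hfe
      rw [e.2.mul_eq_zero_of_ne f.2 (fun h => hfe (Subtype.ext h.symm)), smul_zero]
  exact this.finite

end PrimitiveIdempotents

/-! ### Components of the group algebra away from `e_N`. -/

namespace HybridIndex

variable {p : ℕ} [Fact p.Prime] {G : Type u} [Group G] {N : Subgroup G}

noncomputable instance (i : HybridIndex p N) : Algebra ℤ_[p] i.Component :=
  Algebra.compHom i.Component (algebraMap ℤ_[p] ℚ_[p])

instance (i : HybridIndex p N) : IsScalarTower ℤ_[p] ℚ_[p] i.Component :=
  IsScalarTower.of_algebraMap_eq fun _ => rfl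

/-- The projection of `ℚ_p[G]` onto a simple component. -/
noncomputable def proj (i : HybridIndex p N) : MonoidAlgebra ℚ_[p] G →ₐ[ℚ_[p]] i.Component where
  toFun x := ⟨i.1 * x * i.1, x, rfl⟩
  map_one' := Subtype.ext ((congrArg (· * i.1) (mul_one i.1)).trans i.2.1.idem.eq)
  map_mul' x y := Subtype.ext (by
    change i.1 * (x * y) * i.1 = i.1 * x * i.1 * (i.1 * y * i.1)
    have h := Subring.mem_center_iff.mp i.2.1.central
    have h1 := i.2.1.idem.eq
    rw [← h x, ← h y, mul_assoc x, h1, mul_assoc y, h1, mul_assoc x, ← mul_assoc i.1 y, ← h y,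
      mul_assoc y, h1, ← h (x * y), mul_assoc, mul_assoc, h1])
  map_zero' := Subtype.ext (by
    change i.1 * 0 * i.1 = 0
    rw [mul_zero, zero_mul])
  map_add' x y := Subtype.ext (by
    change i.1 * (x + y) * i.1 = i.1 * x * i.1 + i.1 * y * i.1
    rw [mul_add, add_mul])
  commutes' r := Subtype.ext (by
    change i.1 * algebraMap ℚ_[p] (MonoidAlgebra ℚ_[p] G) r * i.1 = r • i.1
    rw [← Algebra.commutes, mul_assoc, i.2.1.idem.eq, Algebra.smul_def])

theorem proj_val (i : HybridIndex p N) (x : MonoidAlgebra ℚ_[p] G) :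
    (i.proj x).1 = x * i.1 := by
  change i.1 * x * i.1 = x * i.1
  rw [← Subring.mem_center_iff.mp i.2.1.central, mul_assoc, i.2.1.idem.eq]

theorem val_mul (i : HybridIndex p N) (x : i.Component) : x.1 * i.1 = x.1 :=
  ((Subsemigroup.mem_corner_iff i.2.1.idem).mp x.2).2

theorem mul_val (i : HybridIndex p N) (x : i.Component) : i.1 * x.1 = x.1 :=
  ((Subsemigroup.mem_corner_iff i.2.1.idem).mp x.2).1

theorem proj_val_self (i : HybridIndex p N) (x : i.Component) : i.proj x.1 = x :=
  Subtype.ext (by rw [proj_val, val_mul])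

theorem val_mem_center (i : HybridIndex p N) {x : i.Component}
    (hx : x ∈ Subring.center i.Component) : x.1 ∈ Subring.center (MonoidAlgebra ℚ_[p] G) := by
  rw [Subring.mem_center_iff] at hx ⊢
  intro y
  have h := congrArg Subtype.val (hx (i.proj y))
  have h1 : (i.proj y).1 * x.1 = x.1 * (i.proj y).1 := h
  rwa [proj_val, mul_assoc, mul_val, Subring.mem_center_iff.mp i.2.1.central y, ← mul_assoc,
    val_mul] at h1

instance (i : HybridIndex p N) : Nontrivial i.Component :=
  ⟨⟨1, 0, fun h => i.2.1.ne_zero (congrArg Subtype.val h)⟩⟩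

/-- The inclusion of the component is not unital, so a monic `P` killing `x` there only gives `P(x)
e = 0` in the whole algebra; `P · X` does vanish, since `e x = x`. -/
theorem isIntegral_val (i : HybridIndex p N) {x : i.Component} (hx : IsIntegral ℤ_[p] x) :
    IsIntegral ℤ_[p] x.1 := by
  obtain ⟨P, hP, hPx⟩ := hx
  refine ⟨P * Polynomial.X, hP.mul Polynomial.monic_X, ?_⟩
  have h1 : Polynomial.aeval x P = 0 := hPx
  have h2 : (i.proj.restrictScalars ℤ_[p]) (Polynomial.aeval x.1 P) = 0 := by
    rw [← Polynomial.aeval_algHom_apply]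
    have : (i.proj.restrictScalars ℤ_[p]) x.1 = x := proj_val_self i x
    rw [this, h1]
  have h3 : Polynomial.aeval x.1 P * i.1 = 0 := by
    rw [← proj_val]
    exact congrArg Subtype.val h2
  change Polynomial.aeval x.1 (P * Polynomial.X) = 0
  have h4 : Polynomial.aeval x.1 P * (i.1 * x.1) = 0 := by rw [← mul_assoc, h3, zero_mul]
  rw [mul_val] at h4
  rw [map_mul, Polynomial.aeval_X]
  exact h4

/-- The map from `ℤ_p[G]` to a simple component of `ℚ_p[G]`. -/
noncomputable def integralProj (i : HybridIndex p N) :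
    MonoidAlgebra ℤ_[p] G →ₐ[ℤ_[p]] i.Component :=
  (i.proj.restrictScalars ℤ_[p]).comp (MonoidAlgebra.mapAlgHom G (Algebra.ofId ℤ_[p] ℚ_[p]))

theorem integralProj_apply (i : HybridIndex p N) (x : MonoidAlgebra ℤ_[p] G) :
    i.integralProj x = i.proj (MonoidAlgebra.mapAlgHom G (Algebra.ofId ℤ_[p] ℚ_[p]) x) := rfl

instance [Finite G] : Finite (HybridIndex p N) := by
  have : Module.Finite ℚ_[p] (MonoidAlgebra ℚ_[p] G) :=
    Module.Finite.of_basis (MonoidAlgebra.basis G ℚ_[p])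
  have := finite_isPrimitiveCentralIdempotent ℚ_[p] (A := MonoidAlgebra ℚ_[p] G)
  exact Finite.of_injective
    (fun i : HybridIndex p N => (⟨i.1, i.2.1⟩ : {e // IsPrimitiveCentralIdempotent e}))
    fun i j h => Subtype.ext (show i.1 = j.1 from congrArg
      (fun e : {e : MonoidAlgebra ℚ_[p] G // IsPrimitiveCentralIdempotent e} => e.1) h)

theorem mul_eq_zero_of_ne {i j : HybridIndex p N} (h : i ≠ j) : i.1 * j.1 = 0 :=
  i.2.1.mul_eq_zero_of_ne j.2.1 fun h' => h (Subtype.ext h')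

/-- Otherwise the central idempotent `1 - e_N - ∑ e` is nonzero and has a primitive one below it,
which is orthogonal to `e_N` and to every index, though itself an index. -/
theorem sum_eq [Finite G] [Fintype (HybridIndex p N)]
    (hN : traceIdempotent p N ∈ Subring.center (MonoidAlgebra ℚ_[p] G)) :
    ∑ i : HybridIndex p N, i.1 = 1 - traceIdempotent p N := by
  have : Module.Finite ℚ_[p] (MonoidAlgebra ℚ_[p] G) :=
    Module.Finite.of_basis (MonoidAlgebra.basis G ℚ_[p])
  set e := traceIdempotent p N
  have hidem : e * e = e := isIdempotentElem_traceIdempotent (p := p) N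
  set s := ∑ i : HybridIndex p N, i.1
  have hcen : s ∈ Subring.center (MonoidAlgebra ℚ_[p] G) :=
    sum_mem fun i _ => i.2.1.central
  have hse : s * e = 0 := by
    rw [Finset.sum_mul]
    exact Finset.sum_eq_zero fun i _ => i.2.2
  have hsi : ∀ i : HybridIndex p N, i.1 * s = i.1 := fun i => by
    rw [Finset.mul_sum, Finset.sum_eq_single i _ (by simp)]
    · exact i.2.1.idem.eq
    · intro j _ hj
      exact mul_eq_zero_of_ne hj.symm
  have hss : s * s = s := by
    nth_rw 1 [show s = ∑ i : HybridIndex p N, i.1 from rfl]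
    rw [Finset.sum_mul]
    exact Finset.sum_congr rfl fun i _ => hsi i
  have hes : e * s = 0 := by rw [Subring.mem_center_iff.mp hcen, hse]
  by_contra hne
  obtain ⟨f, hf, hfd⟩ := exists_isPrimitiveCentralIdempotent_mul_eq ℚ_[p] (δ := 1 - e - s) (by
      rw [IsIdempotentElem]
      simp only [mul_sub, sub_mul, hss, hes, hse, hidem, mul_one, one_mul]
      abel) (sub_mem (sub_mem (one_mem _) hN) hcen) (fun h => hne (sub_eq_zero.mp h).symm)
  have hfe : f * e = 0 := by
    rw [← hfd, mul_assoc]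
    simp only [sub_mul, hidem, hse, one_mul]
    simp
  have h1 : f * s = f := hsi ⟨f, hf, hfe⟩
  rw [mul_sub, mul_sub, mul_one, hfe, h1, sub_zero, sub_self] at hfd
  exact hf.ne_zero hfd.symm

end HybridIndex

/-! ### Integral group rings and the quotient by `N`. -/

section GroupRing

variable {p : ℕ} [Fact p.Prime] {G : Type u} [Group G]

theorem exists_smul_mem_range_mapAlgHom [Finite G] (x : MonoidAlgebra ℚ_[p] G) :
    ∃ b : ℤ_[p], b ≠ 0 ∧ b • x ∈ integralGroupRing p G := by
  have := Fintype.ofFinite G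
  obtain ⟨b, hb⟩ := IsLocalization.exist_integer_multiples (nonZeroDivisors ℤ_[p])
    (Finset.univ : Finset G) (fun g => x.coeff g)
  refine ⟨b, nonZeroDivisors.coe_ne_zero b, mem_integralGroupRing_iff.mpr fun g => ?_⟩
  obtain ⟨a, ha⟩ := hb g (Finset.mem_univ g)
  exact ⟨a, by simpa using ha.symm⟩

theorem mapAlgHom_injective {k K : Type*} [CommRing k] [CommRing K] [Algebra k K]
    (h : Function.Injective (algebraMap k K)) :
    Function.Injective (MonoidAlgebra.mapAlgHom G (Algebra.ofId k K)) := by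
  intro x y hxy
  ext g
  apply h
  have := congrArg (fun z => z.coeff g) hxy
  simpa using this

/-- An element of the kernel of `k[G] → k[G ⧸ N]` is killed by every `e` fixed by `N`. -/
theorem mul_eq_zero_of_mapDomain_eq_zero {k : Type*} [CommRing k] {N : Subgroup G} [N.Normal]
    {e : MonoidAlgebra k G} (he : ∀ n ∈ N, MonoidAlgebra.of k G n * e = e)
    {x : MonoidAlgebra k G}
    (hx : MonoidAlgebra.mapDomainAlgHom k k (QuotientGroup.mk' N) x = 0) : x * e = 0 := by
  -- As `N` fixes `e`, right multiplication by `e` factors through `k[G ⧸ N]`; `s` is the induced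
  -- map.
  let s : MonoidAlgebra k (G ⧸ N) →ₗ[k] MonoidAlgebra k G :=
    (MonoidAlgebra.basis (G ⧸ N) k).constr k fun q => MonoidAlgebra.of k G q.out * e
  have hs : s ∘ₗ (MonoidAlgebra.mapDomainAlgHom k k (QuotientGroup.mk' N)).toLinearMap =
      LinearMap.mulRight k e := by
    refine (MonoidAlgebra.basis G k).ext fun g => ?_
    have h1 : MonoidAlgebra.mapDomainAlgHom k k (QuotientGroup.mk' N)
        (MonoidAlgebra.basis G k g) = MonoidAlgebra.basis (G ⧸ N) k (g : G ⧸ N) := by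
      simp [MonoidAlgebra.basis_apply]
    rw [LinearMap.comp_apply, AlgHom.toLinearMap_apply, h1, Module.Basis.constr_basis]
    obtain ⟨n, hn⟩ := QuotientGroup.mk_out_eq_mul N g
    rw [hn, map_mul, mul_assoc, he n n.2, MonoidAlgebra.basis_apply]
    rfl
  have := LinearMap.congr_fun hs x
  rw [LinearMap.comp_apply, AlgHom.toLinearMap_apply, hx, map_zero] at this
  exact this.symm

end GroupRing

/-! ### Assembling the decomposition. -/

theorem HybridIndex.unramified_and_nonempty_matrix_algEquiv {p : ℕ} [Fact p.Prime] {G : Type u}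
    [Group G] [Fintype G] {N : Subgroup G} (i : HybridIndex p N) {w : MonoidAlgebra ℤ_[p] G}
    (hw : MonoidAlgebra.mapAlgHom G (Algebra.ofId ℤ_[p] ℚ_[p])
      (∑ g, MonoidAlgebra.of ℤ_[p] G g * w * MonoidAlgebra.of ℤ_[p] G g⁻¹) =
        1 - traceIdempotent p N)
    (hint : ∀ x ∈ Subring.center (MonoidAlgebra ℚ_[p] G), IsIntegral ℤ_[p] x →
      x * (1 - traceIdempotent p N) ∈ integralGroupRing p G) :
    Algebra.Unramified ℤ_[p] i.RingOfIntegers ∧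
    ∃ m : ℕ, Nonempty (i.Component ≃ₐ[ℚ_[p]] Matrix (Fin m) (Fin m) i.CentreField) ∧
      Nonempty (i.integralProj.range ≃ₐ[ℤ_[p]] Matrix (Fin m) (Fin m) i.RingOfIntegers) := by
  refine _root_.unramified_and_nonempty_matrix_algEquiv i.integralProj ?_ w ?_ ?_ ?_
    (Subalgebra.center ℚ_[p] i.Component).val Subtype.val_injective ?_
  · intro x
    obtain ⟨b, hb, y, hy⟩ := exists_smul_mem_range_mapAlgHom x.1
    refine ⟨b, hb, y, ?_⟩
    have h1 : i.proj (b • x.1) = b • x :=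
      (map_smul (i.proj.restrictScalars ℤ_[p]) b x.1).trans
        (congrArg (b • ·) (i.proj_val_self x))
    rw [← h1, ← hy]
    rfl
  · rw [integralProj_apply, hw]
    refine Subtype.ext ?_
    rw [proj_val, sub_mul, one_mul]
    have h1 : traceIdempotent p N * i.1 = 0 := by
      rw [Subring.mem_center_iff.mp i.2.1.central]
      exact i.2.2
    rw [h1, sub_zero]
    rfl
  · intro z hz hzi
    exact (i.2.1.primitive z.1 (congrArg Subtype.val hzi) (i.val_mem_center hz)
      (i.val_mul z)).imp (fun h => Subtype.ext h) (fun h => Subtype.ext h)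
  · intro x hx hxi
    obtain ⟨y, hy⟩ := hint x.1 (i.val_mem_center hx) (i.isIntegral_val hxi)
    refine ⟨y, ?_⟩
    have h1 : x.1 * traceIdempotent p N = 0 := by
      have h2 : x.1 * i.1 * traceIdempotent p N = 0 := by
        rw [mul_assoc]
        exact (congrArg (x.1 * ·) i.2.2).trans (mul_zero _)
      rwa [i.val_mul] at h2
    have h2 : MonoidAlgebra.mapAlgHom G (Algebra.ofId ℤ_[p] ℚ_[p]) y = x.1 := by
      refine hy.trans ?_
      rw [mul_sub, mul_one, h1, sub_zero]
    change i.integralProj y = x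
    rw [integralProj_apply, h2, proj_val_self]
  · intro x
    exact ⟨fun ⟨y, hy⟩ => hy ▸ y.2, fun hx => ⟨⟨x, hx⟩, rfl⟩⟩

theorem mainTheorem11 {G : Type u} [Group G] [Finite G] (N : Subgroup G) [N.Normal]
    (hN : IsFrobeniusKernel N) (p : ℕ) [Fact p.Prime] (hp : ¬ p ∣ Nat.card N) :
    IsHybrid p N ∧
    Finite (HybridIndex p N) ∧
    (∀ i : HybridIndex p N, Algebra.Unramified ℤ_[p] i.RingOfIntegers) ∧
    ∃ m : HybridIndex p N → ℕ,
      (∀ i : HybridIndex p N,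
        Nonempty (i.Component ≃ₐ[ℚ_[p]] Matrix (Fin (m i)) (Fin (m i)) i.CentreField)) ∧
      Nonempty (MonoidAlgebra ℤ_[p] G ≃ₐ[ℤ_[p]]
        MonoidAlgebra ℤ_[p] (G ⧸ N) ×
          (∀ i : HybridIndex p N, Matrix (Fin (m i)) (Fin (m i)) i.RingOfIntegers)) := by
  classical
  have := Fintype.ofFinite G
  have := Fintype.ofFinite (HybridIndex p N)
  obtain ⟨e, w, hw, he, c, hc, hec⟩ := hN.exists_integral_sum_conj_eq hp
  set ι := MonoidAlgebra.mapAlgHom G (Algebra.ofId ℤ_[p] ℚ_[p]) with hι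
  have hιinj : Function.Injective ι := mapAlgHom_injective (IsFractionRing.injective ℤ_[p] ℚ_[p])
  have hιw : ι (∑ g, MonoidAlgebra.of ℤ_[p] G g * w * MonoidAlgebra.of ℤ_[p] G g⁻¹) =
      1 - traceIdempotent p N := by
    rw [hw, map_sub, map_one, he]
  have hιw' : ∑ g, MonoidAlgebra.of ℚ_[p] G g * ι w * MonoidAlgebra.of ℚ_[p] G g⁻¹ =
      1 - traceIdempotent p N := by
    rw [← hιw, map_sum]
    simp only [map_mul, MonoidAlgebra.of_apply, hι, MonoidAlgebra.mapAlgHom_single, map_one]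
  have hcen : traceIdempotent p N ∈ Subring.center (MonoidAlgebra ℚ_[p] G) := by
    have hspan : Submodule.span ℚ_[p] (Set.range (MonoidAlgebra.of ℚ_[p] G)) = ⊤ := by
      have h1 : Set.range (MonoidAlgebra.of ℚ_[p] G) = Set.range (MonoidAlgebra.basis G ℚ_[p]) := by
        congr 1
      rw [h1, Module.Basis.span_eq]
    have h1 := sum_conj_mem_center (MonoidAlgebra.of ℚ_[p] G) hspan (ι w)
    rw [hιw'] at h1
    simpa using sub_mem (one_mem _) h1
  have hint : ∀ x ∈ Subring.center (MonoidAlgebra ℚ_[p] G), IsIntegral ℤ_[p] x →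
      x * (1 - traceIdempotent p N) ∈ integralGroupRing p G := by
    intro x hx hxi
    rw [← hιw']
    exact hxi.mul_sum_conj_mem hx ⟨w, rfl⟩
  have key := fun i : HybridIndex p N => i.unramified_and_nonempty_matrix_algEquiv hιw hint
  choose hunr m hm E using key
  refine ⟨hN.isHybrid hp, inferInstance, hunr, m, hm, ?_⟩
  -- Each `e ∈ J` is central and a root of `X² - X`, so `e = e (1 - e_N)` lies in `ℤ_p[G]`.
  have hε : ∀ i : HybridIndex p N, ∃ ε, ι ε = i.1 := by
    intro i
    have hi : IsIntegral ℤ_[p] i.1 := by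
      refine ⟨Polynomial.X ^ 2 - Polynomial.X, ?_, ?_⟩
      · monicity!
      · simp [pow_two, i.2.1.idem.eq]
    obtain ⟨y, hy⟩ := hint i.1 i.2.1.central hi
    refine ⟨y, hy.trans ?_⟩
    rw [mul_sub, mul_one]
    exact (congrArg (i.1 - ·) i.2.2).trans (sub_zero _)
  choose ε hε using hε
  have hne : ∀ n ∈ N, MonoidAlgebra.of ℤ_[p] G n * e = e := by
    intro n hn
    apply hιinj
    rw [map_mul, he]
    simpa [hι] using of_mul_traceIdempotent (p := p) N hn
  let π := MonoidAlgebra.mapDomainAlgHom ℤ_[p] ℤ_[p] (QuotientGroup.mk' N)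
  have hπe : π e = 1 := by
    rw [hec, finsum_eq_sum_of_fintype, map_smul, map_sum]
    have : ∀ n : N, π (MonoidAlgebra.of ℤ_[p] G n) = 1 := fun n => by
      simp [π, (QuotientGroup.eq_one_iff (n : G)).mpr n.2, MonoidAlgebra.one_def]
    simp only [this, Finset.sum_const, Finset.card_univ]
    rw [← Nat.cast_smul_eq_nsmul ℤ_[p], smul_smul, ← Nat.card_eq_fintype_card, hc, one_smul]
  have hπε : ∀ i, π (ε i) = 0 := by
    intro i
    have h1 : ε i * e = 0 := by
      apply hιinj
      rw [map_mul, hε, he, map_zero]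
      exact i.2.2
    rw [← mul_one (π (ε i)), ← hπe, ← map_mul, h1, map_zero]
  have hθe : ∀ i : HybridIndex p N, i.integralProj e = 0 := by
    intro i
    refine Subtype.ext ?_
    rw [HybridIndex.integralProj_apply, HybridIndex.proj_val, ← hι, he,
      Subring.mem_center_iff.mp i.2.1.central]
    exact i.2.2
  have hθε : ∀ i j : HybridIndex p N, i.integralProj (ε j) = if i = j then 1 else 0 := by
    intro i j
    refine Subtype.ext ?_
    rw [HybridIndex.integralProj_apply, HybridIndex.proj_val, ← hι, hε]
    split_ifs with h
    · subst h
      exact i.2.1.idem.eq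
    · exact HybridIndex.mul_eq_zero_of_ne (Ne.symm h)
  let Θ : ∀ i : HybridIndex p N, MonoidAlgebra ℤ_[p] G →ₐ[ℤ_[p]]
      Matrix (Fin (m i)) (Fin (m i)) i.RingOfIntegers := fun i =>
    ((E i).some : i.integralProj.range →ₐ[ℤ_[p]] _).comp i.integralProj.rangeRestrict
  have hΘ : ∀ i x, Θ i x = 0 ↔ i.integralProj x = 0 := by
    intro i x
    change (E i).some (i.integralProj.rangeRestrict x) = 0 ↔ _
    rw [map_eq_zero_iff _ (E i).some.injective]
    exact Subtype.ext_iff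
  have hΘs : ∀ i, Function.Surjective (Θ i) := fun i =>
    (E i).some.surjective.comp i.integralProj.rangeRestrict_surjective
  have hΘε : ∀ i, Θ i (ε i) = 1 := by
    intro i
    rw [← sub_eq_zero, ← map_one (Θ i), ← map_sub, hΘ, map_sub, hθε, if_pos rfl, map_one, sub_self]
  have hΘε' : ∀ i j, i ≠ j → Θ i (ε j) = 0 := by
    intro i j h
    rw [hΘ, hθε, if_neg h]
  refine ⟨AlgEquiv.ofBijective (π.prod (AlgHom.pi Θ)) ⟨?_, ?_⟩⟩
  · rw [injective_iff_map_eq_zero]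
    intro x hx
    have hx1 : π x = 0 := congrArg Prod.fst hx
    have hx2 : ∀ i, Θ i x = 0 := fun i => congrFun (congrArg Prod.snd hx) i
    apply hιinj
    have h1 : ι x * traceIdempotent p N = 0 := by
      rw [← he, ← map_mul, mul_eq_zero_of_mapDomain_eq_zero hne hx1, map_zero]
    have h2 : ∀ i : HybridIndex p N, ι x * i.1 = 0 := by
      intro i
      rw [← HybridIndex.proj_val, ← HybridIndex.integralProj_apply, (hΘ i x).mp (hx2 i)]
      rfl
    -- An element of the kernel is killed by `e_N` and by every `e ∈ J`, and these sum to `1`.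
    have h3 := congrArg (ι x * ·) (HybridIndex.sum_eq (p := p) (N := N) hcen)
    simp only [Finset.mul_sum, h2, Finset.sum_const_zero, mul_sub, h1, mul_one, sub_zero] at h3
    rw [map_zero, ← h3]
  · rintro ⟨a, b⟩
    have hπs : Function.Surjective π := by
      intro a
      induction a using MonoidAlgebra.induction_on with
      | of q =>
        obtain ⟨g, rfl⟩ := QuotientGroup.mk'_surjective N q
        exact ⟨MonoidAlgebra.of ℤ_[p] G g, by simp [π]⟩
      | add a b ha hb =>
        obtain ⟨a, rfl⟩ := ha
        obtain ⟨b, rfl⟩ := hb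
        exact ⟨a + b, map_add _ _ _⟩
      | smul r a ha =>
        obtain ⟨a, rfl⟩ := ha
        exact ⟨r • a, map_smul _ _ _⟩
    obtain ⟨x₀, rfl⟩ := hπs a
    choose x hx using fun i => hΘs i (b i)
    -- Preimages in the separate factors are glued by the integral orthogonal idempotents.
    refine ⟨x₀ * e + ∑ i, x i * ε i, Prod.ext ?_ (funext fun i => ?_)⟩
    · change π _ = π x₀
      rw [map_add, map_mul, hπe, mul_one, map_sum]
      simp [hπε]
    · change Θ i _ = b i
      rw [map_add, map_mul, (hΘ i e).mpr (hθe i), mul_zero, zero_add, map_sum,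
        Finset.sum_eq_single i _ (by simp), map_mul, hΘε, mul_one, hx]
      intro j _ hj
      rw [map_mul, hΘε' i j hj.symm, mul_zero]
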